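/- Let $m\ge 2$, $n\ge 1$, and let $\Omega\subset\mathbb R^n$ be a bounded open set with boundary of class $C^1$ and outward unit normal $\eta$. Let $a,b>0$ with $2b\cos\frac{\pi}{m+1}<a$ and put $$\bar\lambda_\ell=a+2b\cos\frac{(m+1-\ell)\pi}{m+1},\qquad \ell=1,\dots,m .$$ Consider, for $W=(w_1,\dots,w_m)$, the system $$\partial_t w_\ell-\bar\lambda_\ell\Delta w_\ell=F_\ell(W)\ \text{ in }\Omega\times\{t>0\},\qquad \alpha w_\ell+(1-\alpha)\partial_\eta w_\ell=\rho_\ell\ \text{ on }\partial\Omega\times\{t>0\},\qquad \ell=1,\dots,m,$$ where either $0<\alpha<1$ and all $\rho_\ell\ge0$ (Robin), or $\alpha=0$ and all $\rho_\ell=0$ (Neumann), or $\alpha=1$ and all $\rho_\ell=0$ (Dirichlet). Assume: (A1) $F=(F_\ell)$ is continuously differentiable on $\mathbb R_+^m=[0,\infty)^m$ and locally Lipschitz on $\mathbb R^m$ (an $F$ given only on $\mathbb R_+^m$ is extended by $W\mapsto F(W^+)$, with $W^+$ the componentwise positive part), and $F_\ell(W)\ge0$ whenever $W\in\mathbb R_+^m$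 and $w_\ell=0$. (A2) There are $C_1>0$ and an integer $N\ge1$ with $|F_\ell(W)|\le C_1\bigl(1+\sum_{k=1}^m w_k\bigr)^N$ for all $W\in(0,\infty)^m$ and all $\ell$. (A3) There are constants $\overline D_\ell>0$ such that for all constants $D_\ell\ge\overline D_\ell$ there is $C_2>0$ with $$\sum_{\ell=1}^{m-1}D_\ell F_\ell(W)+F_m(W)\le C_2\Bigl(1+\sum_{\ell=1}^m w_\ell\Bigr)\qquad\text{for all }W\in\mathbb R_+^m .$$ Let $p_m\ge1$ be an integer, let $\theta_1,\dots,\theta_{m-1}>0$, and put $$H_{p_m}(W)=\sum_{p_{m-1}=0}^{p_m}\cdots\sum_{p_1=0}^{p_2}\binom{p_m}{p_{m-1}}\cdots\binom{p_2}{p_1}\,\theta_1^{p_1^2}\cdots\theta_{m-1}^{p_{m-1}^2}\,w_1^{p_1}w_2^{p_2-p_1}\cdots w_m^{p_m-p_{m-1}} .$$ For integers $0\le p_1\le\dots\le p_{m-1}\le p_m-2$ let $(a_{\ell\kappa})$ be the symmetric $m\times m$ matrix with, for $\ell\le\kappa$, $$a_{\ell\kappa}=\frac{\bar\lambda_\ell+\bar\lambda_\kappa}{2}\prod_{k=1}^{\ell-1}\theta_k^{p_k^2}\prod_{k=\ell}^{\kappa-1}\theta_k^{(p_k+1)^2}\prod_{k=\kappa}^{m-1}\theta_k^{(p_k+2)^2},$$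 let $\det[k]$ be its leading principal minors, let $A_{\ell\kappa}=\dfrac{\bar\lambda_\ell+\bar\lambda_\kappa}{2\sqrt{\bar\lambda_\ell\bar\lambda_\kappa}}$, and define $$K_l^2=\bar\lambda_1\bar\lambda_l\prod_{k=1}^{l-1}\theta_k^{2(p_k+1)^2}\prod_{k=l}^{m-1}\theta_k^{2(p_k+2)^2}\Bigl[\prod_{k=1}^{l-1}\theta_k^2-A_{1l}^2\Bigr],$$ $$H_l^2=\bar\lambda_1\sqrt{\bar\lambda_2\bar\lambda_l}\;\theta_1^{2(p_1+1)^2}\prod_{k=2}^{l-1}\theta_k^{(p_k+2)^2+(p_k+1)^2}\prod_{k=l}^{m-1}\theta_k^{2(p_k+2)^2}\bigl[\theta_1^2A_{2l}-A_{12}A_{1l}\bigr],$$ $$H_l^r=M_l^r\prod_{k=1}^{r-2}(\det[k])^{2^{r-k-2}}\quad(3\le r\le l-1),\qquad K_l^r=K_{r-1}^{r-1}K_l^{r-1}-\bigl(H_l^{r-1}\bigr)^2\quad(3\le r\le l),$$ where $M_l^r$ is the determinant of the submatrix of $(a_{\ell\kappa})$ with rows $1,\dots,r$ and columns $1,\dots,r-1,l$.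 Assume that $K_l^l>0$ for $l=2,\dots,m$ and all integers $0\le p_1\le\dots\le p_{m-1}\le p_m-2$. A classical solution on $[0,T_{\max})$, $0<T_{\max}\le\infty$, is a function $W$ such that: $W$ and its spatial gradient are continuous on $(0,T_{\max})\times\overline\Omega$ (the gradient in the sense of a continuous extension from $\Omega$); $\partial_tW$ and the second spatial derivatives exist and are continuous on $(0,T_{\max})\times\Omega$; $W$ satisfies the equations and the boundary conditions for $0<t<T_{\max}$; $W$ is bounded on $(0,T']\times\Omega$ for each $T'<T_{\max}$; the initial value $W(0,\cdot)$ lies in $L^\infty(\Omega)$ and is $\ge0$ a.e. in each component; and $W(t,\cdot)\to W(0,\cdot)$ in $L^1(\Omega)$ as $t\downarrow0$. For such $W$ put $$L(t)=\int_\Omega H_{p_m}(W(t,x))\,dx .$$ Then $L$ is uniformly bounded on $[0,T^*]$ for every $T^*<T_{\max}$, in the following sense: for all real $T$ and $M$ there is a constant $C$, depending only on $T$, $M$ and on $m,n,a,b,\Omega,\alpha,\rho,F,p_m,\theta$, such that for every $T_{\max}\in(0,\infty]$, every classical solution on $[0,T_{\max})$ with $L(0)\le M$, and every $T^*\le T$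 with $T^*<T_{\max}$, the function $H_{p_m}(W(t,\cdot))$ is integrable on $\Omega$ and $|L(t)|\le C$ for all $t\in[0,T^*]$. -/

import Mathlib

noncomputable section

namespace ToeplitzRD

open MeasureTheory Filter Topology Set

/-! Components are indexed by `i : Fin m`; the index `i` stands for the label `ℓ = i + 1`.
The algebraic quantities `lamBar`, `aEntry`, `K`, `H`, and the weights `θ k`, `p k`, carry the
1-based labels `ℓ, κ, l ∈ {1, …, m}` and `k ∈ {1, …, m - 1}`; values at other labels are unused. -/

/-- The eigenvalue `a + 2 b cos ((m + 1 - ℓ) π / (m + 1))` (ascending in `ℓ`) of the tridiagonal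
symmetric Toeplitz matrix with diagonal `a` and off-diagonal `b`. -/
def lamBar (a b : ℝ) (m ℓ : ℕ) : ℝ :=
  a + 2 * b * Real.cos (((m : ℝ) + 1 - (ℓ : ℝ)) * Real.pi / ((m : ℝ) + 1))

/-! ### The weighted homogeneous polynomial -/

/-- The nested sum
`∑_{p_{m-1} ≤ p_m} ⋯ ∑_{p_1 ≤ p_2} C(p_m, p_{m-1}) ⋯ C(p_2, p_1)`
`  θ_1 ^ (p_1²) ⋯ θ_{m-1} ^ (p_{m-1}²) w_1 ^ p_1 w_2 ^ (p_2 - p_1) ⋯ w_m ^ (p_m - p_{m-1})`,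
written by recursion on the number `m` of variables (outermost sum first). -/
def lyapPoly (θ : ℕ → ℝ) : (m : ℕ) → (Fin m → ℝ) → ℕ → ℝ
  | 0, _, _ => 1
  | 1, w, p => w 0 ^ p
  | k + 2, w, p =>
      ∑ q ∈ Finset.range (p + 1),
        (p.choose q : ℝ) * θ (k + 1) ^ (q ^ 2) * lyapPoly θ (k + 1) (Fin.init w) q
          * w (Fin.last (k + 1)) ^ (p - q)

/-! ### The determinant conditions -/

section Determinants

variable (lam θ : ℕ → ℝ) (p : ℕ → ℕ) (m : ℕ)

/-- The symmetric matrix entry `a_{ℓκ}`; for `ℓ ≤ κ` it is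
`(λ_ℓ + λ_κ)/2 · ∏_{k<ℓ} θ_k^{p_k²} · ∏_{ℓ≤k<κ} θ_k^{(p_k+1)²} · ∏_{κ≤k<m} θ_k^{(p_k+2)²}`. -/
def aEntry (ℓ κ : ℕ) : ℝ :=
  (lam ℓ + lam κ) / 2
    * (∏ k ∈ Finset.Ico 1 (min ℓ κ), θ k ^ (p k ^ 2))
    * (∏ k ∈ Finset.Ico (min ℓ κ) (max ℓ κ), θ k ^ ((p k + 1) ^ 2))
    * (∏ k ∈ Finset.Ico (max ℓ κ) m, θ k ^ ((p k + 2) ^ 2))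

/-- The ratio `A_{ℓκ} = (λ_ℓ + λ_κ) / (2 √(λ_ℓ λ_κ))`. -/
def ratioA (ℓ κ : ℕ) : ℝ := (lam ℓ + lam κ) / (2 * Real.sqrt (lam ℓ * lam κ))

/-- The leading principal minor `det[k]` of `(a_{ℓκ})`. -/
def leadMinor (k : ℕ) : ℝ :=
  (Matrix.of fun i j : Fin k => aEntry lam θ p m (i + 1) (j + 1)).det

/-- The minor of `(a_{ℓκ})_{1 ≤ ℓ, κ ≤ l}` after removing the rows `r + 1, …, l` and the columns
`r, …, l - 1`, i.e. with rows `1, …, r` and columns `1, …, r - 1, l`. -/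
def crossMinor (r l : ℕ) : ℝ :=
  (Matrix.of fun i j : Fin r =>
    aEntry lam θ p m (i + 1) (if (j : ℕ) + 1 < r then (j : ℕ) + 1 else l)).det

/-- The quantity `H_l^r` (used for `2 ≤ r < l`). -/
def H (r l : ℕ) : ℝ :=
  if r = 2 then
    lam 1 * Real.sqrt (lam 2 * lam l) * θ 1 ^ (2 * (p 1 + 1) ^ 2)
      * (∏ k ∈ Finset.Ico 2 l, θ k ^ ((p k + 2) ^ 2 + (p k + 1) ^ 2))
      * (∏ k ∈ Finset.Ico l m, θ k ^ (2 * (p k + 2) ^ 2))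
      * (θ 1 ^ 2 * ratioA lam 2 l - ratioA lam 1 2 * ratioA lam 1 l)
  else
    crossMinor lam θ p m r l
      * ∏ k ∈ Finset.Icc 1 (r - 2), leadMinor lam θ p m k ^ (2 ^ (r - k - 2))

/-- The quantity `K_l^r` (used for `2 ≤ r ≤ l`), as `K r l`: an explicit value for `r = 2`, and
`K_l^r = K_{r-1}^{r-1} K_l^{r-1} - (H_l^{r-1})²` for `r ≥ 3`. -/
def K : ℕ → ℕ → ℝ
  | 0, _ => 0
  | 1, _ => 0
  | 2, l =>
      lam 1 * lam l
        * (∏ k ∈ Finset.Ico 1 l, θ k ^ (2 * (p k + 1) ^ 2))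
        * (∏ k ∈ Finset.Ico l m, θ k ^ (2 * (p k + 2) ^ 2))
        * ((∏ k ∈ Finset.Ico 1 l, θ k ^ 2) - ratioA lam 1 l ^ 2)
  | r + 3, l => K (r + 2) (r + 2) * K (r + 2) l - H lam θ p m (r + 2) l ^ 2

end Determinants

/-- The positivity conditions `K_l^l > 0`, `l = 2, …, m`, for all the indices
`0 ≤ p_1 ≤ p_2 ≤ ⋯ ≤ p_{m-1} ≤ P - 2` that occur in the second derivatives of the polynomial. -/
def DetCondition (lam θ : ℕ → ℝ) (m P : ℕ) : Prop :=
  ∀ p : ℕ → ℕ, (∀ k, 1 ≤ k → k + 1 ≤ m - 1 → p k ≤ p (k + 1)) → p (m - 1) + 2 ≤ P →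
    ∀ l, 2 ≤ l → l ≤ m → 0 < K lam θ p m l l

/-! ### Conditions on the reaction terms -/

/-- Smoothness and quasi-positivity. The terms are total functions on `ℝᵐ`, locally Lipschitz;
terms that are given and `C¹` only on the closed orthant `ℝ₊ᵐ` are covered through the extension
`w ↦ F (w⁺)`. -/
structure SmoothQuasiPositive {m : ℕ} (F : (Fin m → ℝ) → Fin m → ℝ) : Prop where
  locallyLipschitz : LocallyLipschitz F
  contDiffOn : ContDiffOn ℝ 1 F {w | ∀ i, 0 ≤ w i}
  quasiPositive : ∀ (i : Fin m) (w : Fin m → ℝ), (∀ j, 0 ≤ w j) → w i = 0 → 0 ≤ F w i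

/-- Polynomial growth on the open positive orthant. -/
def PolynomialGrowth {m : ℕ} (F : (Fin m → ℝ) → Fin m → ℝ) : Prop :=
  ∃ C₁ : ℝ, 0 < C₁ ∧ ∃ N : ℕ, 1 ≤ N ∧ ∀ (i : Fin m) (w : Fin m → ℝ), (∀ j, 0 < w j) →
    |F w i| ≤ C₁ * (1 + ∑ j, w j) ^ N

/-- The inequality `∑_{ℓ<m} D_ℓ F_ℓ(W) + F_m(W) ≤ C₂ (1 + ∑ w_ℓ)` on `ℝ₊ᵐ`, for all
sufficiently large constants `D_ℓ`; the bound `C₂` may depend on the `D_ℓ`. -/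
def MassInequality {m : ℕ} (F : (Fin m → ℝ) → Fin m → ℝ) : Prop :=
  ∃ Dbar : Fin m → ℝ, (∀ i, 0 < Dbar i) ∧
    ∀ D : Fin m → ℝ, (∀ i, Dbar i ≤ D i) →
      ∃ C₂ : ℝ, 0 < C₂ ∧ ∀ w : Fin m → ℝ, (∀ j, 0 ≤ w j) →
        ∑ i : Fin m, (if (i : ℕ) + 1 = m then 1 else D i) * F w i ≤ C₂ * (1 + ∑ j, w j)

/-! ### Domains of class `C¹` -/

section Domain

variable {n : ℕ}

/-- Near `x`, the set `Ω` is `{φ < 0}` for a `C¹` function `φ` with non-vanishing gradient. -/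
def IsLocalDefiningFunction (Ω : Set (EuclideanSpace ℝ (Fin n))) (x : EuclideanSpace ℝ (Fin n))
    (φ : EuclideanSpace ℝ (Fin n) → ℝ) : Prop :=
  ContDiffAt ℝ 1 φ x ∧ gradient φ x ≠ 0 ∧ ∀ᶠ y in 𝓝 x, (y ∈ Ω ↔ φ y < 0)

/-- `Ω` has a boundary of class `C¹` and lies locally on one side of it. -/
def HasC1Boundary (Ω : Set (EuclideanSpace ℝ (Fin n))) : Prop :=
  ∀ x ∈ frontier Ω, ∃ φ, IsLocalDefiningFunction Ω x φ

/-- `ν` is the outward unit normal of `Ω` at the boundary point `x`. -/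
def IsOutwardNormal (Ω : Set (EuclideanSpace ℝ (Fin n))) (x ν : EuclideanSpace ℝ (Fin n)) : Prop :=
  ∃ φ, IsLocalDefiningFunction Ω x φ ∧ ν = ‖gradient φ x‖⁻¹ • gradient φ x

end Domain

/-! ### The boundary value problem -/

/-- Nonhomogeneous Robin, homogeneous Neumann, or homogeneous Dirichlet boundary data for
`α w_ℓ + (1 - α) ∂_η w_ℓ = ρ_ℓ`. -/
def AdmissibleBoundaryData {m : ℕ} (α : ℝ) (ρ : Fin m → ℝ) : Prop :=
  (0 < α ∧ α < 1 ∧ ∀ i, 0 ≤ ρ i) ∨ (α = 0 ∧ ∀ i, ρ i = 0) ∨ (α = 1 ∧ ∀ i, ρ i = 0)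

/-- The space-time set `(0, Tmax) × S`. -/
def cylinder {n : ℕ} (Tmax : EReal) (S : Set (EuclideanSpace ℝ (Fin n))) :
    Set (ℝ × EuclideanSpace ℝ (Fin n)) :=
  {q | 0 < q.1 ∧ (q.1 : EReal) < Tmax ∧ q.2 ∈ S}

/-- `w` is a classical solution on `[0, Tmax)` (`Tmax ≤ ∞`) of
`∂_t w_ℓ - λ_ℓ Δ w_ℓ = F_ℓ(w)` in `Ω`, `α w_ℓ + (1 - α) ∂_η w_ℓ = ρ_ℓ` on `∂Ω`, with nonnegative
initial data `w 0` in `L^∞(Ω)`. The initial data are attained in `L¹(Ω)`, with `w` bounded on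
`(0, T] × Ω` for each `T < Tmax`. No sign is assumed on `w` at positive times. -/
structure IsClassicalSolution {m n : ℕ} (lam : Fin m → ℝ) (F : (Fin m → ℝ) → Fin m → ℝ)
    (Ω : Set (EuclideanSpace ℝ (Fin n))) (α : ℝ) (ρ : Fin m → ℝ) (Tmax : EReal)
    (w : ℝ → EuclideanSpace ℝ (Fin n) → Fin m → ℝ) : Prop where
  initial_memLp : ∀ i, MemLp (fun x => w 0 x i) ⊤ (volume.restrict Ω)
  initial_nonneg : ∀ i, ∀ᵐ x ∂(volume.restrict Ω), 0 ≤ w 0 x i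
  initial_attained : ∀ i,
    Tendsto (fun t => ∫ x in Ω, |w t x i - w 0 x i|) (𝓝[>] (0 : ℝ)) (𝓝 0)
  locally_bounded : ∀ T : ℝ, (T : EReal) < Tmax →
    ∃ B : ℝ, ∀ t ∈ Ioc 0 T, ∀ x ∈ Ω, ∀ i, |w t x i| ≤ B
  continuous_closure : ∀ i, ContinuousOn (fun q : ℝ × EuclideanSpace ℝ (Fin n) => w q.1 q.2 i)
    (cylinder Tmax (closure Ω))
  time_differentiable : ∀ i, ∀ q ∈ cylinder Tmax Ω, DifferentiableAt ℝ (fun s => w s q.2 i) q.1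
  time_deriv_continuous : ∀ i, ContinuousOn
    (fun q : ℝ × EuclideanSpace ℝ (Fin n) => deriv (fun s => w s q.2 i) q.1) (cylinder Tmax Ω)
  space_contDiff : ∀ i, ∀ t : ℝ, 0 < t → (t : EReal) < Tmax →
    ContDiffOn ℝ 2 (fun x => w t x i) Ω
  space_deriv2_continuous : ∀ i, ContinuousOn
    (fun q : ℝ × EuclideanSpace ℝ (Fin n) => iteratedFDeriv ℝ 2 (fun x => w q.1 x i) q.2)
    (cylinder Tmax Ω)
  equation : ∀ i, ∀ q ∈ cylinder Tmax Ω,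
    deriv (fun s => w s q.2 i) q.1 - lam i * Laplacian.laplacian (fun x => w q.1 x i) q.2
      = F (w q.1 q.2) i
  /-- The spatial gradient extends continuously up to the boundary, and the extension `G` gives
  the normal derivative `∂_η w_ℓ = ⟨G, ν⟩` in the boundary condition. -/
  boundary : ∃ G : Fin m → ℝ → EuclideanSpace ℝ (Fin n) → EuclideanSpace ℝ (Fin n), ∀ i,
    ContinuousOn (fun q : ℝ × EuclideanSpace ℝ (Fin n) => G i q.1 q.2)
      (cylinder Tmax (closure Ω)) ∧
    (∀ q ∈ cylinder Tmax Ω, G i q.1 q.2 = gradient (fun x => w q.1 x i) q.2) ∧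
    (∀ q ∈ cylinder Tmax (frontier Ω), ∀ ν, IsOutwardNormal Ω q.2 ν →
      α * w q.1 q.2 i + (1 - α) * inner ℝ (G i q.1 q.2) ν = ρ i)

/-- The functional `L(t) = ∫_Ω H_P(w(t, x)) dx`. -/
def lyapFunctional {m n : ℕ} (θ : ℕ → ℝ) (P : ℕ) (Ω : Set (EuclideanSpace ℝ (Fin n)))
    (w : ℝ → EuclideanSpace ℝ (Fin n) → Fin m → ℝ) (t : ℝ) : ℝ :=
  ∫ x in Ω, lyapPoly θ m (w t x) P

end ToeplitzRD

end

noncomputable section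

namespace ToeplitzRD

open MeasureTheory Filter Topology Set Metric

/-! On the closed positive orthant, a homogeneous polynomial of degree `P` with positive
coefficients lies between two positive multiples of `(∑ w_i) ^ P`. A bound for the integral of one
such polynomial therefore bounds the integral of any other, and `L` itself is never differentiated.
The energy estimate is carried out for `symPoly P c`, whose coefficients `c = gaussCoeff s d` are
chosen for the purpose (`exists_lyapunov_coeff`): a large `s` makes the diagonal of the diffusion
Hessian dominate, and then large `d_i` for the components other than the last bring the reaction
terms under the mass inequality.

The boundary flux is bounded above in each case. For Robin data the loss `α w` has one degree more
than the source `ρ`; for Neumann data the flux is zero; for Dirichlet data a nonnegative function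
vanishing at a boundary point has nonpositive outward derivative there (`inner_normal_nonpos`). The
outcome is a Grönwall inequality whose constants depend on the data only
(`exists_integral_symPoly_le`).

The boundary is only `C¹`, and time derivatives and second space derivatives are not controlled up
to it. Integration by parts is therefore done against Lipschitz cutoffs `χ` of the distance to the
complement (`exists_boundaryCutoff`). Almost everywhere `∇χ` vanishes or points along an inward
normal. Its total mass is bounded independently of the width of the layer: a `C¹` field `X`
transversal to the boundary gives `∫ |∇χ| ≤ 2 ∫ |div X|`. As the width tends to zero, uniform
continuity of `w` and its gradient up to the boundary turns the layer term into the boundary flux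
(`integral_le_of_isLyapunovAlong`).

Nonnegativity of `w` at positive times comes from the same energy inequality, applied to `∑ (w_i⁻)³`
(`IsClassicalSolution.nonneg`). -/

lemma eventually_lt_of_hasDerivAt_pos {f : ℝ → ℝ} {f' : ℝ} (hf : HasDerivAt f f' 0)
    (hf' : 0 < f') : ∀ᶠ s in 𝓝[>] (0 : ℝ), f 0 < f s := by
  have h1 := (hasDerivAt_iff_tendsto_slope.1 hf).mono_left
    (nhdsWithin_mono 0 (fun s (hs : 0 < s) => ne_of_gt hs))
  filter_upwards [h1.eventually (lt_mem_nhds hf'), self_mem_nhdsWithin] with s hs hs0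
  rw [slope_def_field, sub_zero] at hs
  have h0 : (0 : ℝ) < s := hs0
  have := (div_pos_iff_of_pos_right h0).1 hs
  linarith

/-! ### Touching balls, normals, and the gradient of the distance function. -/

section Geometry

variable {n : ℕ} {Ω : Set (EuclideanSpace ℝ (Fin n))}

lemma IsLocalDefiningFunction.differentiableAt {y : EuclideanSpace ℝ (Fin n)}
    {φ : EuclideanSpace ℝ (Fin n) → ℝ} (hφ : IsLocalDefiningFunction Ω y φ) :
    DifferentiableAt ℝ φ y := hφ.1.differentiableAt (by norm_num)

lemma IsLocalDefiningFunction.hasDerivAt_line {y : EuclideanSpace ℝ (Fin n)}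
    {φ : EuclideanSpace ℝ (Fin n) → ℝ} (hφ : IsLocalDefiningFunction Ω y φ)
    (v : EuclideanSpace ℝ (Fin n)) :
    HasDerivAt (fun s : ℝ => φ (y + s • v)) (inner ℝ (gradient φ y) v) 0 := by
  have h := hφ.differentiableAt.hasFDerivAt.hasLineDerivAt v
  rw [inner_gradient_left]
  exact h

/-- If a ball inside `Ω` touches the boundary at `y`, then its radius at `y` is the outward
normal given by any local defining function. -/
lemma IsLocalDefiningFunction.normal_eq {x y : EuclideanSpace ℝ (Fin n)}
    {φ : EuclideanSpace ℝ (Fin n) → ℝ} (hφ : IsLocalDefiningFunction Ω y φ)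
    (hy : y ∉ Ω) (hxy : x ≠ y) (hball : ball x (dist x y) ⊆ Ω) :
    ‖gradient φ y‖⁻¹ • gradient φ y = ‖y - x‖⁻¹ • (y - x) := by
  by_contra hne
  set g := gradient φ y with hg
  have hg0 : 0 < ‖g‖ := norm_pos_iff.2 hφ.2.1
  have hR : 0 < ‖y - x‖ := norm_pos_iff.2 (sub_ne_zero.2 hxy.symm)
  set G := ‖g‖⁻¹ • g with hG
  set U := ‖y - x‖⁻¹ • (y - x) with hU
  have hG1 : ‖G‖ = 1 := by rw [hG, norm_smul, norm_inv, norm_norm, inv_mul_cancel₀ hg0.ne']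
  have hU1 : ‖U‖ = 1 := by rw [hU, norm_smul, norm_inv, norm_norm, inv_mul_cancel₀ hR.ne']
  have hlt : inner ℝ G U < 1 := (inner_lt_one_iff_real_of_norm_eq_one hG1 hU1).2 hne
  have hgG : g = ‖g‖ • G := by rw [hG, smul_smul, mul_inv_cancel₀ hg0.ne', one_smul]
  have hxU : y - x = ‖y - x‖ • U := by rw [hU, smul_smul, mul_inv_cancel₀ hR.ne', one_smul]
  -- If the unit vectors `G` and `U` differ, moving from `y` along `G - U` increases `φ`, hence
  -- stays outside `Ω`, while it decreases the distance to `x`, hence enters the ball inside `Ω`.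
  have hgv : 0 < inner ℝ g (G - U) := by
    rw [hgG, real_inner_smul_left, inner_sub_right, real_inner_self_eq_norm_sq, hG1]
    exact mul_pos hg0 (by linarith)
  have hxv : 0 < - (2 * inner ℝ (y - x) (G - U)) := by
    rw [hxU, real_inner_smul_left, inner_sub_right, real_inner_self_eq_norm_sq, hU1,
      real_inner_comm]
    nlinarith
  have h1 := eventually_lt_of_hasDerivAt_pos (hφ.hasDerivAt_line (G - U)) hgv
  have hd : HasDerivAt (fun s : ℝ => - ‖(y - x) + s • (G - U)‖ ^ 2)
      (- (2 * inner ℝ (y - x) (G - U))) 0 := by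
    have h : HasDerivAt (fun s : ℝ => (y - x) + s • (G - U)) (G - U) 0 := by
      simpa using ((hasDerivAt_id (0 : ℝ)).smul_const (G - U)).const_add (y - x)
    have h' := h.norm_sq.fun_neg
    simpa using h'
  have h2 := eventually_lt_of_hasDerivAt_pos hd hxv
  have h3 : ∀ᶠ s in 𝓝[>] (0 : ℝ), (y + s • (G - U) ∈ Ω ↔ φ (y + s • (G - U)) < 0) := by
    have hc : Tendsto (fun s : ℝ => y + s • (G - U)) (𝓝[>] 0) (𝓝 y) := by
      have : Continuous (fun s : ℝ => y + s • (G - U)) := by fun_prop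
      have h := this.tendsto 0
      simp only [zero_smul, add_zero] at h
      exact h.mono_left nhdsWithin_le_nhds
    exact hc.eventually hφ.2.2
  obtain ⟨s, hs1, hs2, hs3⟩ := (h1.and (h2.and h3)).exists
  simp only [zero_smul, add_zero] at hs1 hs2
  have hy0 : 0 ≤ φ y := by
    by_contra h
    exact hy ((hφ.2.2.self_of_nhds).2 (not_le.1 h))
  have hin : y + s • (G - U) ∈ Ω := by
    apply hball
    rw [mem_ball, dist_eq_norm, dist_comm, dist_eq_norm]
    have e : y + s • (G - U) - x = (y - x) + s • (G - U) := by abel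
    rw [e]
    have : ‖(y - x) + s • (G - U)‖ ^ 2 < ‖y - x‖ ^ 2 := by linarith
    exact lt_of_pow_lt_pow_left₀ 2 hR.le this
  have := hs3.1 hin
  linarith

/-- A local defining function at a boundary point is one at all nearby points, and its normal
varies continuously. -/
lemma IsLocalDefiningFunction.eventually {z : EuclideanSpace ℝ (Fin n)}
    {φ : EuclideanSpace ℝ (Fin n) → ℝ} (hφ : IsLocalDefiningFunction Ω z φ) :
    ∀ᶠ y in 𝓝 z, IsLocalDefiningFunction Ω y φ ∧
      1 / 2 ≤ inner ℝ (‖gradient φ y‖⁻¹ • gradient φ y) (‖gradient φ z‖⁻¹ • gradient φ z) := by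
  have hc : ContinuousAt (gradient φ) z := by
    have : ContinuousAt (fderiv ℝ φ) z := hφ.1.continuousAt_fderiv (by norm_num)
    exact (InnerProductSpace.toDual ℝ _).symm.continuous.continuousAt.comp this
  have hg0 : 0 < ‖gradient φ z‖ := norm_pos_iff.2 hφ.2.1
  have h1 : ∀ᶠ y in 𝓝 z, ContDiffAt ℝ 1 φ y := hφ.1.eventually (by simp)
  have h2 : ∀ᶠ y in 𝓝 z, gradient φ y ≠ 0 := hc.eventually_ne hφ.2.1
  have h3 := eventually_eventually_nhds.2 hφ.2.2
  have h4 : ContinuousAt (fun y => inner ℝ (‖gradient φ y‖⁻¹ • gradient φ y)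
      (‖gradient φ z‖⁻¹ • gradient φ z)) z :=
    ((hc.norm.inv₀ hg0.ne').smul hc).inner continuousAt_const
  have h5 : (1 / 2 : ℝ) < inner ℝ (‖gradient φ z‖⁻¹ • gradient φ z)
      (‖gradient φ z‖⁻¹ • gradient φ z) := by
    rw [real_inner_self_eq_norm_sq, norm_smul, norm_inv, norm_norm, inv_mul_cancel₀ hg0.ne']
    norm_num
  filter_upwards [h1, h2, h3, h4.eventually (lt_mem_nhds h5)] with y a b c d
  exact ⟨⟨a, b, c⟩, d.le⟩

/-- `ν` is the direction of a ball in `Ω` that is centred at `x` and touches the boundary at `y`. -/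
structure TouchesAt (Ω : Set (EuclideanSpace ℝ (Fin n))) (x y ν : EuclideanSpace ℝ (Fin n)) :
    Prop where
  mem : x ∈ Ω
  mem_frontier : y ∈ frontier Ω
  ne : x ≠ y
  ball_subset : ball x (dist x y) ⊆ Ω
  normal_eq : ν = ‖y - x‖⁻¹ • (y - x)

lemma TouchesAt.norm_eq_one {x y ν : EuclideanSpace ℝ (Fin n)} (h : TouchesAt Ω x y ν) :
    ‖ν‖ = 1 := by
  have hR : 0 < ‖y - x‖ := norm_pos_iff.2 (sub_ne_zero.2 h.ne.symm)
  rw [h.normal_eq, norm_smul, norm_inv, norm_norm, inv_mul_cancel₀ hR.ne']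

lemma TouchesAt.notMem (hΩ : IsOpen Ω) {x y ν : EuclideanSpace ℝ (Fin n)}
    (h : TouchesAt Ω x y ν) : y ∉ Ω := by
  have := h.mem_frontier
  rw [hΩ.frontier_eq] at this
  exact this.2

lemma TouchesAt.isOutwardNormal (hΩo : IsOpen Ω) (hΩ : HasC1Boundary Ω)
    {x y ν : EuclideanSpace ℝ (Fin n)} (h : TouchesAt Ω x y ν) : IsOutwardNormal Ω y ν := by
  obtain ⟨φ, hφ⟩ := hΩ y h.mem_frontier
  exact ⟨φ, hφ, by rw [h.normal_eq, hφ.normal_eq (h.notMem hΩo) h.ne h.ball_subset]⟩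

/-- The field `∑ β z • N z` glues the normals at finitely many boundary points by bump functions.
Its size is fixed by `Ω` alone, and it is what bounds the mass of all cutoff gradients at once. -/
lemma exists_transversal_field (hΩo : IsOpen Ω) (hΩb : Bornology.IsBounded Ω)
    (hΩ : HasC1Boundary Ω) :
    ∃ (t : Finset (EuclideanSpace ℝ (Fin n)))
      (β : EuclideanSpace ℝ (Fin n) → EuclideanSpace ℝ (Fin n) → ℝ)
      (N : EuclideanSpace ℝ (Fin n) → EuclideanSpace ℝ (Fin n)) (r : ℝ), 0 < r ∧
      (∀ z ∈ t, ContDiff ℝ 1 (β z) ∧ HasCompactSupport (β z)) ∧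
      ∀ x y ν, TouchesAt Ω x y ν → dist x y ≤ r →
        1 / 2 ≤ ∑ z ∈ t, β z x * inner ℝ ν (N z) := by
  classical
  have hK : IsCompact (frontier Ω) :=
    Metric.isCompact_of_isClosed_isBounded isClosed_frontier
      (hΩb.closure.subset frontier_subset_closure)
  have h1 : ∀ z ∈ frontier Ω, ∃ (N : EuclideanSpace ℝ (Fin n)) (δ : ℝ), 0 < δ ∧
      ∀ x y ν, TouchesAt Ω x y ν → dist y z < δ → 1 / 2 ≤ inner ℝ ν N := by
    intro z hz
    obtain ⟨φ, hφ⟩ := hΩ z hz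
    obtain ⟨δ, hδ, h⟩ := Metric.eventually_nhds_iff.1 hφ.eventually
    refine ⟨‖gradient φ z‖⁻¹ • gradient φ z, δ, hδ, fun x y ν ht hy => ?_⟩
    obtain ⟨h1, h2⟩ := h hy
    rw [h1.normal_eq (ht.notMem hΩo) ht.ne ht.ball_subset, ← ht.normal_eq] at h2
    exact h2
  choose! N δ hδ hN using h1
  obtain ⟨t, ht, hcov⟩ := hK.elim_nhds_subcover (fun z => ball z (δ z / 8))
    (fun z hz => ball_mem_nhds z (by have := hδ z hz; positivity))
  -- The balls of radius `δ/8` cover the boundary and `r ≤ δ/8`. Hence `x` lies within `δ/4` of some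
  -- centre, where the bump is `1`. Wherever a bump is nonzero, `y` lies within `δ/2 + δ/8 < δ` of
  -- its centre, so no term is negative.
  let b : ∀ z, z ∈ t → ContDiffBump z := fun z hz =>
    ⟨δ z / 4, δ z / 2, by have := hδ z (ht z hz); positivity,
      by have := hδ z (ht z hz); linarith⟩
  let β : EuclideanSpace ℝ (Fin n) → EuclideanSpace ℝ (Fin n) → ℝ :=
    fun z => if hz : z ∈ t then b z hz else 0
  obtain ⟨r, hr, hrt⟩ : ∃ r : ℝ, 0 < r ∧ ∀ z ∈ t, r ≤ δ z / 8 := by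
    rcases t.eq_empty_or_nonempty with h | h
    · exact ⟨1, one_pos, by simp [h]⟩
    · refine ⟨t.inf' h (fun z => δ z / 8), ?_, fun z hz => Finset.inf'_le _ hz⟩
      rw [Finset.lt_inf'_iff]
      intro z hz
      have := hδ z (ht z hz); positivity
  refine ⟨t, β, N, r, hr, fun z hz => ?_, fun x y ν htch hd => ?_⟩
  · simp only [β, hz, dif_pos]
    exact ⟨(b z hz).contDiff, (b z hz).hasCompactSupport⟩
  · have hterm : ∀ z ∈ t, 0 ≤ β z x * inner ℝ ν (N z) := by
      intro z hz
      have hδz := hδ z (ht z hz)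
      simp only [β, hz, dif_pos]
      by_cases hx : dist x z < δ z / 2
      · have : dist y z < δ z := by
          have := dist_triangle_left y z x
          have := hrt z hz
          linarith
        have := hN z (ht z hz) x y ν htch this
        exact mul_nonneg (b z hz).nonneg (by linarith)
      · rw [(b z hz).zero_of_le_dist (not_lt.1 hx), zero_mul]
    obtain ⟨z, hz, hyz⟩ := mem_iUnion₂.1 (hcov htch.mem_frontier)
    have hδz := hδ z (ht z hz)
    have hrz := hrt z hz
    rw [mem_ball] at hyz
    refine le_trans ?_ (Finset.single_le_sum hterm hz)
    have h1 : β z x = 1 := by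
      simp only [β, hz, dif_pos]
      apply (b z hz).one_of_mem_closedBall
      rw [mem_closedBall]
      have := dist_triangle x y z
      change dist x z ≤ δ z / 4
      linarith
    rw [h1, one_mul]
    exact hN z (ht z hz) x y ν htch (by linarith)

lemma exists_touchesAt (hn : 0 < n) (hΩo : IsOpen Ω) (hΩb : Bornology.IsBounded Ω)
    {x : EuclideanSpace ℝ (Fin n)} (hx : x ∈ Ω) :
    ∃ y, infDist x Ωᶜ = dist x y ∧ TouchesAt Ω x y (‖y - x‖⁻¹ • (y - x)) := by
  have : Nonempty (Fin n) := ⟨⟨0, hn⟩⟩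
  have hne : Ωᶜ.Nonempty := by
    by_contra h
    rw [not_nonempty_iff_eq_empty, compl_empty_iff] at h
    rw [h] at hΩb
    exact NormedSpace.unbounded_univ ℝ (EuclideanSpace ℝ (Fin n)) hΩb
  obtain ⟨y, hy, hxy⟩ := hΩo.isClosed_compl.exists_infDist_eq_dist hne x
  have hne : x ≠ y := fun h => hy (h ▸ hx)
  have hb : ball x (dist x y) ⊆ Ω := by
    intro z hz
    by_contra hz'
    have := infDist_le_dist_of_mem (x := x) (show z ∈ Ωᶜ from hz')
    rw [hxy, dist_comm x z] at this
    exact absurd (mem_ball.1 hz) (not_lt.2 this)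
  refine ⟨y, hxy, hx, ?_, hne, hb, rfl⟩
  rw [hΩo.frontier_eq]
  refine ⟨closure_mono hb ?_, hy⟩
  rw [closure_ball x (dist_pos.2 hne).ne', mem_closedBall, dist_comm]

/-- Where it is differentiable, the distance to the complement has gradient `-ν`. -/
lemma gradient_infDist_compl {x y ν : EuclideanSpace ℝ (Fin n)}
    (ht : TouchesAt Ω x y ν) (hxy : infDist x Ωᶜ = dist x y) (hyΩ : y ∉ Ω)
    (hd : DifferentiableAt ℝ (fun z => infDist z Ωᶜ) x) :
    gradient (fun z => infDist z Ωᶜ) x = - ν := by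
  set d : EuclideanSpace ℝ (Fin n) → ℝ := fun z => infDist z Ωᶜ with hdd
  have hR : 0 < ‖y - x‖ := norm_pos_iff.2 (sub_ne_zero.2 ht.ne.symm)
  have h1 : ‖gradient d x‖ ≤ 1 := by
    have : ‖fderiv ℝ d x‖ ≤ (1 : NNReal) :=
      norm_fderiv_le_of_lipschitz ℝ (lipschitz_infDist_pt Ωᶜ)
    rw [← toDual_gradient, LinearIsometryEquiv.norm_map] at this
    simpa using this
  -- Moving towards the nearest point `y` decreases the distance at unit rate at least. Together
  -- with `‖∇d‖ ≤ 1` this is the equality case of Cauchy–Schwarz, so `‖∇d + ν‖² ≤ 0`.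
  have h2 : inner ℝ (gradient d x) ν ≤ -1 := by
    by_contra hcon
    rw [not_le] at hcon
    have hl : HasDerivAt (fun s : ℝ => d (x + s • ν) + s) (inner ℝ (gradient d x) ν + 1) 0 := by
      rw [inner_gradient_left]
      exact HasDerivAt.add (hd.hasFDerivAt.hasLineDerivAt ν) (hasDerivAt_id 0)
    have hev := eventually_lt_of_hasDerivAt_pos hl (by linarith)
    have hev2 : ∀ᶠ s in 𝓝[>] (0 : ℝ), s < ‖y - x‖ :=
      nhdsWithin_le_nhds (gt_mem_nhds hR)
    obtain ⟨s, hs, hs2, hs0⟩ := (hev.and (hev2.and self_mem_nhdsWithin)).exists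
    have hs0' : (0 : ℝ) < s := hs0
    have hle : d (x + s • ν) ≤ dist (x + s • ν) y :=
      infDist_le_dist_of_mem (show y ∈ Ωᶜ from hyΩ)
    have hdist : dist (x + s • ν) y = ‖y - x‖ - s := by
      have e : x + s • ν - y = -((‖y - x‖ - s) • ν) := by
        have : y - x = ‖y - x‖ • ν := by
          rw [ht.normal_eq, smul_smul, mul_inv_cancel₀ hR.ne', one_smul]
        rw [sub_smul, ← this]; abel
      rw [dist_eq_norm, e, norm_neg, norm_smul, ht.norm_eq_one, mul_one, Real.norm_eq_abs,
        abs_of_pos (by linarith)]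
    have h0 : d x = ‖y - x‖ := by
      simp only [hdd]; rw [hxy, dist_comm, dist_eq_norm]
    simp only [zero_smul, add_zero] at hs
    linarith
  have h3 : ‖gradient d x + ν‖ ^ 2 ≤ 0 := by
    rw [norm_add_sq_real, ht.norm_eq_one]
    have := norm_nonneg (gradient d x)
    nlinarith
  have h4 : gradient d x + ν = 0 := by
    rw [← norm_eq_zero]
    exact pow_eq_zero_iff two_ne_zero |>.1 (le_antisymm h3 (sq_nonneg _))
  exact eq_neg_of_add_eq_zero_left h4

end Geometry

/-! ### Boundary cutoffs with gradient mass independent of the layer width. -/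

section Cutoff

variable {n : ℕ} {Ω : Set (EuclideanSpace ℝ (Fin n))}

lemma deriv_smoothTransition_of_notMem {x : ℝ} (hx : x ∉ Icc (0 : ℝ) 1) :
    deriv Real.smoothTransition x = 0 := by
  rw [mem_Icc, not_and_or, not_le, not_le] at hx
  rcases hx with hx | hx
  · have : Real.smoothTransition =ᶠ[𝓝 x] fun _ => 0 := by
      filter_upwards [gt_mem_nhds hx] with y hy
      exact Real.smoothTransition.zero_of_nonpos hy.le
    rw [this.deriv_eq, deriv_const]
  · have : Real.smoothTransition =ᶠ[𝓝 x] fun _ => 1 := by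
      filter_upwards [lt_mem_nhds hx] with y hy
      exact Real.smoothTransition.one_of_one_le hy.le
    rw [this.deriv_eq, deriv_const]

lemma exists_lipschitzWith_smoothTransition :
    ∃ C : NNReal, LipschitzWith C Real.smoothTransition := by
  have h1 : Continuous (deriv Real.smoothTransition) :=
    (Real.smoothTransition.contDiff (n := 1)).continuous_deriv (by norm_num)
  have h2 : HasCompactSupport (deriv Real.smoothTransition) :=
    HasCompactSupport.intro isCompact_Icc (fun x hx => deriv_smoothTransition_of_notMem hx)
  obtain ⟨C, hC⟩ := h1.bounded_above_of_compact_support h2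
  refine ⟨C.toNNReal, lipschitzWith_of_nnnorm_deriv_le
    ((Real.smoothTransition.contDiff (n := 1)).differentiable (by norm_num)) fun x => ?_⟩
  rw [← NNReal.coe_le_coe, coe_nnnorm, Real.coe_toNNReal']
  exact (hC x).trans (le_max_left _ _)

lemma measurable_gradient (χ : EuclideanSpace ℝ (Fin n) → ℝ) : Measurable (gradient χ) :=
  (InnerProductSpace.toDual ℝ _).symm.continuous.measurable.comp (measurable_fderiv ℝ χ)

lemma norm_gradient (χ : EuclideanSpace ℝ (Fin n) → ℝ) (x : EuclideanSpace ℝ (Fin n)) :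
    ‖gradient χ x‖ = ‖fderiv ℝ χ x‖ := by
  rw [← toDual_gradient, LinearIsometryEquiv.norm_map]

lemma gradient_eq_zero_of_notMem_tsupport {χ : EuclideanSpace ℝ (Fin n) → ℝ}
    {x : EuclideanSpace ℝ (Fin n)} (hx : x ∉ tsupport χ) : gradient χ x = 0 := by
  have : fderiv ℝ χ x = 0 := by
    by_contra h
    exact hx (support_fderiv_subset ℝ h)
  simp [gradient, this]

lemma integrable_gradient {χ : EuclideanSpace ℝ (Fin n) → ℝ} {C : NNReal}
    (hL : LipschitzWith C χ) (hc : HasCompactSupport χ) : Integrable (gradient χ) := by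
  rw [← integrableOn_iff_integrable_of_support_subset (s := tsupport χ)]
  · refine Measure.integrableOn_of_bounded (M := C) hc.measure_lt_top.ne
      (measurable_gradient χ).aestronglyMeasurable (Eventually.of_forall fun x => ?_)
    rw [norm_gradient]
    exact norm_fderiv_le_of_lipschitz ℝ hL
  · intro x hx
    by_contra h
    exact hx (gradient_eq_zero_of_notMem_tsupport h)

/-- A Lipschitz cutoff that is `1` at distance `r` from the boundary, whose gradient points along
inward normals and has total mass at most `S`. -/
structure IsBoundaryCutoff (Ω : Set (EuclideanSpace ℝ (Fin n))) (S r : ℝ)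
    (χ : EuclideanSpace ℝ (Fin n) → ℝ) : Prop where
  lipschitz : ∃ C, LipschitzWith C χ
  compact : HasCompactSupport χ
  tsupport_subset : tsupport χ ⊆ Ω
  nonneg : ∀ x, 0 ≤ χ x
  le_one : ∀ x, χ x ≤ 1
  eq_one : ∀ x, r ≤ infDist x Ωᶜ → χ x = 1
  integral_le : ∫ x, ‖gradient χ x‖ ≤ S
  gradient_eq : ∀ᵐ x, gradient χ x = 0 ∨
    ∃ y ν, TouchesAt Ω x y ν ∧ dist x y ≤ r ∧ gradient χ x = -(‖gradient χ x‖ • ν)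

lemma integral_fderiv_mul_eq {f χ : EuclideanSpace ℝ (Fin n) → ℝ} {C : NNReal}
    (hf : ContDiff ℝ 1 f) (hfc : HasCompactSupport f)
    (hL : LipschitzWith C χ) (hc : HasCompactSupport χ) (v : EuclideanSpace ℝ (Fin n)) :
    ∫ x, fderiv ℝ f x v * χ x = - ∫ x, inner ℝ (gradient χ x) v * f x := by
  obtain ⟨D, hD⟩ := ContDiff.lipschitzWith_of_hasCompactSupport hfc hf (by simp)
  have h := LipschitzWith.integral_lineDeriv_mul_eq (μ := volume) hD hL hc v
  have h1 : ∀ x, lineDeriv ℝ f x v = fderiv ℝ f x v := fun x =>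
    ((hf.differentiable (by simp)) x).lineDeriv_eq_fderiv
  simp only [h1] at h
  rw [h, ← integral_neg]
  apply integral_congr_ae
  filter_upwards [hL.ae_differentiableAt] with x hx
  rw [hx.lineDeriv_eq_fderiv, inner_gradient_left, map_neg, neg_mul]

/-- Transversality gives `½ ∫ ‖∇χ‖ ≤ -∫ ⟨∇χ, X⟩ = ∫ χ div X ≤ ∫ |div X|` up to splitting `X` into
its summands `β z • N z`, and the right side does not see `r`. -/
theorem exists_boundaryCutoff (hn : 0 < n) (hΩo : IsOpen Ω) (hΩb : Bornology.IsBounded Ω)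
    (hΩ : HasC1Boundary Ω) :
    ∃ S : ℝ, 0 ≤ S ∧ ∀ r : ℝ, 0 < r → ∃ χ, IsBoundaryCutoff Ω S r χ := by
  obtain ⟨t, β, N, r₀, hr₀, hβ, hX⟩ := exists_transversal_field hΩo hΩb hΩ
  refine ⟨2 * ∑ z ∈ t, ∫ x, |fderiv ℝ (β z) x (N z)|, by positivity, fun r hr => ?_⟩
  obtain ⟨L, hL⟩ := exists_lipschitzWith_smoothTransition
  set d : EuclideanSpace ℝ (Fin n) → ℝ := fun z => infDist z Ωᶜ with hdd
  have hdL : LipschitzWith 1 d := lipschitz_infDist_pt Ωᶜ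
  set ε : ℝ := min r r₀ / 2 with hε
  have hε0 : 0 < ε := by have := lt_min hr hr₀; positivity
  have h2r : 2 * ε ≤ r := by rw [hε]; have := min_le_left r r₀; linarith
  have h2r₀ : 2 * ε ≤ r₀ := by rw [hε]; have := min_le_right r r₀; linarith
  -- This is `0` where `d ≤ ε` and `1` where `d ≥ 2ε`; `2ε` is at most `r` and at most the distance
  -- on which the field is transversal.
  set χ : EuclideanSpace ℝ (Fin n) → ℝ := fun x => Real.smoothTransition (d x / ε - 1) with hχ
  have hχL : ∃ C, LipschitzWith C χ := by
    have h1 : LipschitzWith (ε⁻¹.toNNReal) (fun s : ℝ => s / ε - 1) := by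
      apply LipschitzWith.of_dist_le_mul
      intro x y
      rw [Real.dist_eq, Real.dist_eq, Real.coe_toNNReal _ (inv_nonneg.2 hε0.le)]
      rw [show x / ε - 1 - (y / ε - 1) = ε⁻¹ * (x - y) by field_simp; ring, abs_mul,
        abs_of_pos (inv_pos.2 hε0)]
    exact ⟨_, hL.comp (h1.comp hdL)⟩
  obtain ⟨C, hC⟩ := hχL
  have hclosed : IsClosed {x | ε ≤ d x} := isClosed_le continuous_const hdL.continuous
  have hts : tsupport χ ⊆ {x | ε ≤ d x} := by
    apply closure_minimal _ hclosed
    intro x hx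
    by_contra h
    apply hx
    apply Real.smoothTransition.zero_of_nonpos
    have : d x / ε ≤ 1 := (div_le_one hε0).2 (not_le.1 h).le
    linarith
  have hsub : {x | ε ≤ d x} ⊆ Ω := by
    intro x hx
    by_contra h
    have : d x = 0 := infDist_zero_of_mem (show x ∈ Ωᶜ from h)
    have hx' : ε ≤ d x := hx
    linarith
  have hcomp : HasCompactSupport χ :=
    (Metric.isCompact_of_isClosed_isBounded (isClosed_tsupport χ) (hΩb.subset (hts.trans hsub)))
  have hgrad : ∀ᵐ x, gradient χ x = 0 ∨
      ∃ y ν, TouchesAt Ω x y ν ∧ dist x y ≤ 2 * ε ∧ gradient χ x = -(‖gradient χ x‖ • ν) := by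
    -- By Rademacher's theorem `d` is differentiable almost everywhere; there `∇χ` is a nonnegative
    -- multiple of `∇d = -ν`, because the transition function is monotone.
    filter_upwards [hdL.ae_differentiableAt] with x hx
    by_cases hxt : x ∈ tsupport χ
    swap
    · exact Or.inl (gradient_eq_zero_of_notMem_tsupport hxt)
    have hxΩ := hsub (hts hxt)
    obtain ⟨y, hxy, ht⟩ := exists_touchesAt hn hΩo hΩb hxΩ
    have hgd := gradient_infDist_compl ht hxy (ht.notMem hΩo) hx
    set k := deriv Real.smoothTransition (d x / ε - 1) * ε⁻¹ with hk
    have hder : HasFDerivAt χ (k • fderiv ℝ d x) x := by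
      have h1 : HasDerivAt Real.smoothTransition (deriv Real.smoothTransition (d x / ε - 1))
          (d x / ε - 1) :=
        (((Real.smoothTransition.contDiff (n := 1)).differentiable (by norm_num)) _).hasDerivAt
      have h2 : HasFDerivAt (fun x => d x / ε - 1) (ε⁻¹ • fderiv ℝ d x) x := by
        have := (hx.hasFDerivAt.mul_const ε⁻¹).sub_const 1
        simpa [div_eq_mul_inv] using this
      have := h1.comp_hasFDerivAt x h2
      rwa [smul_smul] at this
    have hg : gradient χ x = k • gradient d x := by
      simp only [gradient, hder.fderiv, map_smul]
    by_cases hk0 : k = 0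
    · left; rw [hg, hk0, zero_smul]
    right
    refine ⟨y, _, ht, ?_, ?_⟩
    · rw [← hxy]
      by_contra hcon
      apply hk0
      rw [hk, deriv_smoothTransition_of_notMem, zero_mul]
      intro h
      apply hcon
      have := h.2
      have h3 : d x / ε ≤ 2 := by linarith
      rwa [div_le_iff₀ hε0] at h3
    · have hknn : 0 ≤ k := mul_nonneg Real.smoothTransition.monotone.deriv_nonneg (by positivity)
      rw [hg, hgd, norm_smul, norm_neg, ht.norm_eq_one, mul_one, Real.norm_of_nonneg hknn,
        smul_neg]
  refine ⟨χ, ⟨C, hC⟩, hcomp, hts.trans hsub, fun x => Real.smoothTransition.nonneg _,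
    fun x => Real.smoothTransition.le_one _, ?_, ?_, ?_⟩
  · intro x hx
    apply Real.smoothTransition.one_of_one_le
    have : 2 ≤ d x / ε := by rw [le_div_iff₀ hε0]; exact h2r.trans hx
    linarith
  · have hgi := integrable_gradient hC hcomp
    have hinteg : ∀ z ∈ t, Integrable (fun x => inner ℝ (gradient χ x) (N z) * β z x) := by
      intro z hz
      obtain ⟨D, hD⟩ := (hβ z hz).1.continuous.bounded_above_of_compact_support (hβ z hz).2
      exact (hgi.inner_const (N z)).mul_bdd
        (hβ z hz).1.continuous.aestronglyMeasurable (Eventually.of_forall hD)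
    have h1 : ∫ x, (1 / 2) * ‖gradient χ x‖ ≤
        ∫ x, - ∑ z ∈ t, inner ℝ (gradient χ x) (N z) * β z x := by
      apply integral_mono_ae (hgi.norm.const_mul _) (integrable_finsetSum _ hinteg).neg
      filter_upwards [hgrad] with x hx
      change 1 / 2 * ‖gradient χ x‖ ≤ - ∑ z ∈ t, inner ℝ (gradient χ x) (N z) * β z x
      rcases hx with hx | ⟨y, ν, ht, hd, hx⟩
      · simp only [hx, inner_zero_left, zero_mul, Finset.sum_const_zero, neg_zero, norm_zero,
          mul_zero, le_refl]
      · have h2 := hX x y ν ht (hd.trans h2r₀)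
        have h3 : - ∑ z ∈ t, inner ℝ (gradient χ x) (N z) * β z x
            = ‖gradient χ x‖ * ∑ z ∈ t, β z x * inner ℝ ν (N z) := by
          rw [← Finset.sum_neg_distrib, Finset.mul_sum]
          apply Finset.sum_congr rfl
          intro z _
          conv_lhs => rw [hx]
          rw [inner_neg_left, real_inner_smul_left]
          ring
        rw [h3, mul_comm]
        exact mul_le_mul_of_nonneg_left h2 (norm_nonneg _)
    rw [integral_const_mul, integral_neg, integral_finsetSum _ hinteg,
      ← Finset.sum_neg_distrib] at h1
    have h2 : ∑ z ∈ t, - ∫ x, inner ℝ (gradient χ x) (N z) * β z x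
        ≤ ∑ z ∈ t, ∫ x, |fderiv ℝ (β z) x (N z)| := by
      apply Finset.sum_le_sum
      intro z hz
      rw [← integral_fderiv_mul_eq (hβ z hz).1 (hβ z hz).2 hC hcomp (N z)]
      have hfi : Integrable (fun x => fderiv ℝ (β z) x (N z)) :=
        (((hβ z hz).1.continuous_fderiv (by simp)).clm_apply
          continuous_const).integrable_of_hasCompactSupport ((hβ z hz).2.fderiv_apply ℝ (N z))
      refine integral_mono (hfi.mul_bdd (c := 1) hC.continuous.aestronglyMeasurable
        (Eventually.of_forall fun x => ?_)) hfi.abs fun x => ?_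
      · rw [Real.norm_of_nonneg (Real.smoothTransition.nonneg _)]
        exact Real.smoothTransition.le_one _
      · have h3 := Real.smoothTransition.nonneg (d x / ε - 1)
        have h4 := Real.smoothTransition.le_one (d x / ε - 1)
        calc fderiv ℝ (β z) x (N z) * χ x ≤ |fderiv ℝ (β z) x (N z)| * χ x :=
              mul_le_mul_of_nonneg_right (le_abs_self _) h3
          _ ≤ |fderiv ℝ (β z) x (N z)| := mul_le_of_le_one_right (abs_nonneg _) h4
    linarith
  · filter_upwards [hgrad] with x hx
    rcases hx with hx | ⟨y, ν, ht, hd, hx⟩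
    · exact Or.inl hx
    · exact Or.inr ⟨y, ν, ht, hd.trans h2r, hx⟩

end Cutoff

/-! ### Integration by parts inside the domain and the divergence of the flux. -/

section InteriorCalculus

variable {n m : ℕ} {Ω : Set (EuclideanSpace ℝ (Fin n))}

lemma continuous_mul_of_tsupport_subset (hΩo : IsOpen Ω) {f χ : EuclideanSpace ℝ (Fin n) → ℝ}
    (hf : ContinuousOn f Ω) (hχ : Continuous χ) (hts : tsupport χ ⊆ Ω) :
    Continuous fun x => f x * χ x := by
  rw [continuous_iff_continuousAt]
  intro x
  by_cases hx : x ∈ tsupport χ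
  · exact (hf.continuousAt (hΩo.mem_nhds (hts hx))).mul hχ.continuousAt
  · have h : (fun x => f x * χ x) =ᶠ[𝓝 x] fun _ => 0 := by
      filter_upwards [notMem_tsupport_iff_eventuallyEq.1 hx] with y hy
      simp [hy]
    exact continuousAt_const.congr h.symm

lemma integrable_mul_of_tsupport_subset (hΩo : IsOpen Ω) {f χ : EuclideanSpace ℝ (Fin n) → ℝ}
    (hf : ContinuousOn f Ω) (hχ : Continuous χ) (hc : HasCompactSupport χ)
    (hts : tsupport χ ⊆ Ω) : Integrable fun x => f x * χ x :=
  (continuous_mul_of_tsupport_subset hΩo hf hχ hts).integrable_of_hasCompactSupport hc.mul_left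

lemma integrable_inner_gradient_mul {f χ : EuclideanSpace ℝ (Fin n) → ℝ} {C : NNReal}
    (hf : ContinuousOn f Ω) (hL : LipschitzWith C χ) (hc : HasCompactSupport χ)
    (hts : tsupport χ ⊆ Ω) (v : EuclideanSpace ℝ (Fin n)) :
    Integrable fun x => inner ℝ (gradient χ x) v * f x := by
  rw [← integrableOn_iff_integrable_of_support_subset (s := tsupport χ)]
  · exact ((integrable_gradient hL hc).inner_const v).integrableOn.mul_continuousOn
      (hf.mono hts) hc
  · intro x hx
    by_contra h
    apply hx
    simp only [gradient_eq_zero_of_notMem_tsupport h, inner_zero_left, zero_mul]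

/-- Integration by parts against a Lipschitz function with compact support in `Ω`. -/
lemma integral_fderiv_mul_eq_of_contDiffOn (hΩo : IsOpen Ω)
    {f χ : EuclideanSpace ℝ (Fin n) → ℝ} {C : NNReal}
    (hf : ContDiffOn ℝ 1 f Ω) (hL : LipschitzWith C χ) (hc : HasCompactSupport χ)
    (hts : tsupport χ ⊆ Ω) (v : EuclideanSpace ℝ (Fin n)) :
    ∫ x, fderiv ℝ f x v * χ x = - ∫ x, inner ℝ (gradient χ x) v * f x := by
  obtain ⟨L, hLc, hKL, hLΩ⟩ := exists_compact_between hc hΩo hts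
  -- Since `ψ = 1` near the support of `χ`, replacing `f` by `ψ * f` changes neither integrand and
  -- gives a compactly supported `C¹` function on the whole space.
  obtain ⟨ψ, hψ1, hψ0, -⟩ := exists_contMDiffMap_one_nhds_of_subset_interior
    (n := 1) (modelWithCornersSelf ℝ (EuclideanSpace ℝ (Fin n))) (isClosed_tsupport χ) hKL
  have hψ : ContDiff ℝ 1 ψ := ψ.contMDiff.contDiff
  have hψs : tsupport ψ ⊆ L := closure_minimal
    (fun x hx => by by_contra h; exact hx (hψ0 x h)) hLc.isClosed
  have hψc : HasCompactSupport ψ := hLc.of_isClosed_subset (isClosed_tsupport _) hψs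
  have hg : ContDiff ℝ 1 (fun x => ψ x * f x) := by
    rw [contDiff_iff_contDiffAt]
    intro x
    by_cases hx : x ∈ tsupport ψ
    · exact hψ.contDiffAt.mul (hf.contDiffAt (hΩo.mem_nhds (hLΩ (hψs hx))))
    · have h : (fun x => ψ x * f x) =ᶠ[𝓝 x] fun _ => 0 := by
        filter_upwards [notMem_tsupport_iff_eventuallyEq.1 hx] with y hy
        simp [hy]
      exact contDiffAt_const.congr_of_eventuallyEq h
  have hmain := integral_fderiv_mul_eq hg hψc.mul_right hL hc v
  have hev : ∀ x ∈ tsupport χ, (fun x => ψ x * f x) =ᶠ[𝓝 x] f := by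
    intro x hx
    filter_upwards [eventually_nhdsSet_iff_forall.1 hψ1 x hx] with y hy
    rw [hy, one_mul]
  have h1 : ∀ x, fderiv ℝ (fun x => ψ x * f x) x v * χ x = fderiv ℝ f x v * χ x := by
    intro x
    by_cases hx : x ∈ tsupport χ
    · rw [(hev x hx).fderiv_eq]
    · rw [image_eq_zero_of_notMem_tsupport hx, mul_zero, mul_zero]
  have h2 : ∀ x, inner ℝ (gradient χ x) v * (ψ x * f x) = inner ℝ (gradient χ x) v * f x := by
    intro x
    by_cases hx : x ∈ tsupport χ
    · have := (hev x hx).self_of_nhds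
      dsimp only at this
      rw [this]
    · rw [gradient_eq_zero_of_notMem_tsupport hx, inner_zero_left, zero_mul, zero_mul]
  simpa only [h1, h2] using hmain

/-- `Ψ₁` and `Ψ₂` are the first and second partial derivatives of the `C²` function `Ψ`. -/
structure IsC2Density (Ψ : (Fin m → ℝ) → ℝ) (Ψ₁ : Fin m → (Fin m → ℝ) → ℝ)
    (Ψ₂ : Fin m → Fin m → (Fin m → ℝ) → ℝ) : Prop where
  hasFDerivAt : ∀ w, HasFDerivAt Ψ
    (∑ i, Ψ₁ i w • ContinuousLinearMap.proj (R := ℝ) (φ := fun _ : Fin m => ℝ) i) w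
  hasFDerivAt₁ : ∀ i w, HasFDerivAt (Ψ₁ i)
    (∑ j, Ψ₂ i j w • ContinuousLinearMap.proj (R := ℝ) (φ := fun _ : Fin m => ℝ) j) w
  continuous₂ : ∀ i j, Continuous (Ψ₂ i j)

variable {Ψ : (Fin m → ℝ) → ℝ} {Ψ₁ : Fin m → (Fin m → ℝ) → ℝ}
    {Ψ₂ : Fin m → Fin m → (Fin m → ℝ) → ℝ}

lemma IsC2Density.contDiff₁ (h : IsC2Density Ψ Ψ₁ Ψ₂) (i : Fin m) : ContDiff ℝ 1 (Ψ₁ i) := by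
  rw [contDiff_one_iff_fderiv]
  refine ⟨fun w => (h.hasFDerivAt₁ i w).differentiableAt, ?_⟩
  have : fderiv ℝ (Ψ₁ i) = fun w => ∑ j, Ψ₂ i j w •
      ContinuousLinearMap.proj (R := ℝ) (φ := fun _ : Fin m => ℝ) j :=
    funext fun w => (h.hasFDerivAt₁ i w).fderiv
  rw [this]
  exact continuous_finsetSum _ fun j _ => (h.continuous₂ i j).smul continuous_const

lemma IsC2Density.contDiff (h : IsC2Density Ψ Ψ₁ Ψ₂) : ContDiff ℝ 1 Ψ := by
  rw [contDiff_one_iff_fderiv]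
  refine ⟨fun w => (h.hasFDerivAt w).differentiableAt, ?_⟩
  have : fderiv ℝ Ψ = fun w => ∑ j, Ψ₁ j w •
      ContinuousLinearMap.proj (R := ℝ) (φ := fun _ : Fin m => ℝ) j :=
    funext fun w => (h.hasFDerivAt w).fderiv
  rw [this]
  exact continuous_finsetSum _ fun j _ => (h.contDiff₁ j).continuous.smul continuous_const

lemma contDiffOn_fderiv_apply (hΩo : IsOpen Ω) {f : EuclideanSpace ℝ (Fin n) → ℝ}
    (hf : ContDiffOn ℝ 2 f Ω) (v : EuclideanSpace ℝ (Fin n)) :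
    ContDiffOn ℝ 1 (fun x => fderiv ℝ f x v) Ω :=
  (hf.fderiv_of_isOpen hΩo (by norm_num)).clm_apply contDiffOn_const

lemma fderiv_fderiv_apply (hΩo : IsOpen Ω) {f : EuclideanSpace ℝ (Fin n) → ℝ}
    (hf : ContDiffOn ℝ 2 f Ω) {x : EuclideanSpace ℝ (Fin n)} (hx : x ∈ Ω)
    (v : EuclideanSpace ℝ (Fin n)) :
    HasFDerivAt (fun x => fderiv ℝ f x v) ((fderiv ℝ (fderiv ℝ f) x).flip v) x := by
  have h1 : DifferentiableAt ℝ (fderiv ℝ f) x :=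
    ((hf.fderiv_of_isOpen hΩo (m := 1) (by norm_num)).contDiffAt (hΩo.mem_nhds hx)).differentiableAt
      (by norm_num)
  have := h1.hasFDerivAt.clm_apply (hasFDerivAt_const v x)
  simpa using this

/-- The component in direction `v` of the flux `∑ i, λ i Ψ₁ i (u) ∇ u i`. -/
def fluxComp (lam : Fin m → ℝ) (Ψ₁ : Fin m → (Fin m → ℝ) → ℝ)
    (u : EuclideanSpace ℝ (Fin n) → Fin m → ℝ) (v x : EuclideanSpace ℝ (Fin n)) : ℝ :=
  ∑ i, lam i * Ψ₁ i (u x) * fderiv ℝ (fun x => u x i) x v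

variable {lam : Fin m → ℝ} {u : EuclideanSpace ℝ (Fin n) → Fin m → ℝ}

lemma contDiffOn_fluxComp (hΩo : IsOpen Ω) (h : IsC2Density Ψ Ψ₁ Ψ₂)
    (hu : ∀ i, ContDiffOn ℝ 2 (fun x => u x i) Ω) (v : EuclideanSpace ℝ (Fin n)) :
    ContDiffOn ℝ 1 (fluxComp lam Ψ₁ u v) Ω := by
  have hu1 : ContDiffOn ℝ 1 u Ω := contDiffOn_pi.2 fun i => (hu i).of_le (by norm_num)
  exact ContDiffOn.sum fun i _ => (contDiffOn_const.mul ((h.contDiff₁ i).comp_contDiffOn hu1)).mul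
    (contDiffOn_fderiv_apply hΩo (hu i) v)

lemma fderiv_fluxComp (hΩo : IsOpen Ω) (h : IsC2Density Ψ Ψ₁ Ψ₂)
    (hu : ∀ i, ContDiffOn ℝ 2 (fun x => u x i) Ω) {x : EuclideanSpace ℝ (Fin n)} (hx : x ∈ Ω)
    (v : EuclideanSpace ℝ (Fin n)) :
    fderiv ℝ (fluxComp lam Ψ₁ u v) x v =
      ∑ i, lam i * Ψ₁ i (u x) * iteratedFDeriv ℝ 2 (fun x => u x i) x ![v, v] +
      ∑ i, ∑ j, lam i * Ψ₂ i j (u x) *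
        (fderiv ℝ (fun x => u x i) x v * fderiv ℝ (fun x => u x j) x v) := by
  have hu1 : HasFDerivAt u (ContinuousLinearMap.pi fun i => fderiv ℝ (fun x => u x i) x) x := by
    rw [hasFDerivAt_pi']
    intro i
    have := (((hu i).contDiffAt (hΩo.mem_nhds hx)).differentiableAt (by norm_num)).hasFDerivAt
    exact this
  have hder : ∀ i, HasFDerivAt (fun x => lam i * Ψ₁ i (u x) * fderiv ℝ (fun x => u x i) x v)
      _ x := fun i =>
    ((((h.hasFDerivAt₁ i (u x)).comp x hu1).const_mul (lam i)).mul
      (fderiv_fderiv_apply hΩo (hu i) hx v))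
  have hs := HasFDerivAt.fun_sum (u := Finset.univ) fun i _ => hder i
  have : fderiv ℝ (fluxComp lam Ψ₁ u v) x = _ := hs.fderiv
  rw [this, ← Finset.sum_add_distrib]
  rw [sum_apply]
  apply Finset.sum_congr rfl
  intro i _
  simp only [Function.comp_apply, add_apply, smul_apply, ContinuousLinearMap.flip_apply,
    ContinuousLinearMap.comp_apply, sum_apply, ContinuousLinearMap.proj_apply,
    ContinuousLinearMap.pi_apply, smul_eq_mul, Finset.mul_sum, iteratedFDeriv_two_apply,
    Matrix.cons_val_zero, Matrix.cons_val_one]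
  congr 1
  refine Finset.sum_congr rfl fun j _ => ?_
  ring

lemma laplacian_eq_sum (f : EuclideanSpace ℝ (Fin n) → ℝ) (x : EuclideanSpace ℝ (Fin n)) :
    Laplacian.laplacian f x = ∑ k, iteratedFDeriv ℝ 2 f x
      ![EuclideanSpace.basisFun (Fin n) ℝ k, EuclideanSpace.basisFun (Fin n) ℝ k] := by
  rw [InnerProductSpace.laplacian_eq_iteratedFDeriv_orthonormalBasis f
    (EuclideanSpace.basisFun (Fin n) ℝ)]

lemma inner_eq_sum_basis (a b : EuclideanSpace ℝ (Fin n)) :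
    inner ℝ a b = ∑ k, inner ℝ a (EuclideanSpace.basisFun (Fin n) ℝ k) *
      inner ℝ b (EuclideanSpace.basisFun (Fin n) ℝ k) := by
  rw [← (EuclideanSpace.basisFun (Fin n) ℝ).sum_inner_mul_inner a b]
  simp only [real_inner_comm]

lemma sum_fderiv_fluxComp (hΩo : IsOpen Ω) (h : IsC2Density Ψ Ψ₁ Ψ₂)
    (hu : ∀ i, ContDiffOn ℝ 2 (fun x => u x i) Ω) {x : EuclideanSpace ℝ (Fin n)} (hx : x ∈ Ω) :
    ∑ k, fderiv ℝ (fluxComp lam Ψ₁ u (EuclideanSpace.basisFun (Fin n) ℝ k)) x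
        (EuclideanSpace.basisFun (Fin n) ℝ k) =
      ∑ i, lam i * Ψ₁ i (u x) * Laplacian.laplacian (fun x => u x i) x +
      ∑ i, ∑ j, lam i * Ψ₂ i j (u x) *
        inner ℝ (gradient (fun x => u x i) x) (gradient (fun x => u x j) x) := by
  simp only [fderiv_fluxComp hΩo h hu hx, Finset.sum_add_distrib]
  congr 1
  · rw [Finset.sum_comm]
    simp only [← Finset.mul_sum, laplacian_eq_sum]
  · rw [Finset.sum_comm]
    apply Finset.sum_congr rfl
    intro i _
    rw [Finset.sum_comm]
    apply Finset.sum_congr rfl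
    intro j _
    rw [← Finset.mul_sum, inner_eq_sum_basis]
    simp only [inner_gradient_left]

/-- The integrand without `χ` is the divergence of the flux minus the diffusion Hessian, which is
nonnegative. After integration by parts, `-∇χ = ‖∇χ‖ ν` turns what remains into `‖∇χ‖` times the
normal flux in the layer. -/
lemma integral_laplacian_mul_cutoff_le (hΩo : IsOpen Ω) (h : IsC2Density Ψ Ψ₁ Ψ₂)
    (hu : ∀ i, ContDiffOn ℝ 2 (fun x => u x i) Ω) {S r b : ℝ} (hb : 0 ≤ b)
    {χ : EuclideanSpace ℝ (Fin n) → ℝ} (hχ : IsBoundaryCutoff Ω S r χ)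
    (hflux : ∀ x y ν, TouchesAt Ω x y ν → dist x y ≤ r →
      ∑ i, lam i * Ψ₁ i (u x) * inner ℝ (gradient (fun x => u x i) x) ν ≤ b)
    (hhess : ∀ x ∈ Ω, 0 ≤ ∑ i, ∑ j, lam i * Ψ₂ i j (u x) *
        inner ℝ (gradient (fun x => u x i) x) (gradient (fun x => u x j) x))
    (hlap : ContinuousOn
      (fun x => ∑ i, lam i * Ψ₁ i (u x) * Laplacian.laplacian (fun x => u x i) x) Ω) :
    ∫ x, (∑ i, lam i * Ψ₁ i (u x) * Laplacian.laplacian (fun x => u x i) x) * χ x ≤ b * S := by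
  obtain ⟨C, hC⟩ := hχ.lipschitz
  set e := EuclideanSpace.basisFun (Fin n) ℝ
  have hfc := contDiffOn_fluxComp (lam := lam) hΩo h hu
  have hi1 : ∀ k, Integrable fun x => fderiv ℝ (fluxComp lam Ψ₁ u (e k)) x (e k) * χ x := fun k =>
    integrable_mul_of_tsupport_subset hΩo
      (((hfc (e k)).continuousOn_fderiv_of_isOpen hΩo (by norm_num)).clm_apply continuousOn_const)
      hC.continuous hχ.compact hχ.tsupport_subset
  have hi2 : ∀ k, Integrable fun x => inner ℝ (gradient χ x) (e k) * fluxComp lam Ψ₁ u (e k) x :=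
    fun k => integrable_inner_gradient_mul (hfc (e k)).continuousOn hC hχ.compact
      hχ.tsupport_subset (e k)
  calc ∫ x, (∑ i, lam i * Ψ₁ i (u x) * Laplacian.laplacian (fun x => u x i) x) * χ x
      ≤ ∫ x, ∑ k, fderiv ℝ (fluxComp lam Ψ₁ u (e k)) x (e k) * χ x := by
        apply integral_mono (integrable_mul_of_tsupport_subset hΩo hlap hC.continuous hχ.compact
          hχ.tsupport_subset) (integrable_finsetSum _ fun k _ => hi1 k)
        intro x
        dsimp only
        by_cases hx : x ∈ Ω
        · rw [← Finset.sum_mul, sum_fderiv_fluxComp hΩo h hu hx]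
          have := hhess x hx
          exact mul_le_mul_of_nonneg_right (by linarith) (hχ.nonneg x)
        · have : χ x = 0 := image_eq_zero_of_notMem_tsupport fun h => hx (hχ.tsupport_subset h)
          simp [this]
    _ = ∫ x, - ∑ k, inner ℝ (gradient χ x) (e k) * fluxComp lam Ψ₁ u (e k) x := by
        rw [integral_finsetSum _ fun k _ => hi1 k, integral_neg,
          integral_finsetSum _ fun k _ => hi2 k, ← Finset.sum_neg_distrib]
        exact Finset.sum_congr rfl fun k _ => integral_fderiv_mul_eq_of_contDiffOn hΩo (hfc (e k))
          hC hχ.compact hχ.tsupport_subset (e k)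
    _ ≤ ∫ x, b * ‖gradient χ x‖ := by
        apply integral_mono_ae (integrable_finsetSum _ fun k _ => hi2 k).neg
          ((integrable_gradient hC hχ.compact).norm.const_mul b)
        filter_upwards [hχ.gradient_eq] with x hx
        change - ∑ k, inner ℝ (gradient χ x) (e k) * fluxComp lam Ψ₁ u (e k) x ≤ _
        rcases hx with hx | ⟨y, ν, ht, hd, hx⟩
        · simp only [hx, inner_zero_left, zero_mul, Finset.sum_const_zero, neg_zero, norm_zero,
            mul_zero, le_refl]
        · have h1 : - ∑ k, inner ℝ (gradient χ x) (e k) * fluxComp lam Ψ₁ u (e k) x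
              = ‖gradient χ x‖ *
                ∑ i, lam i * Ψ₁ i (u x) * inner ℝ (gradient (fun x => u x i) x) ν := by
            have h2 : ∀ i, inner ℝ (gradient (fun x => u x i) x) ν =
                ∑ k, inner ℝ ν (e k) * fderiv ℝ (fun x => u x i) x (e k) := by
              intro i
              rw [real_inner_comm, inner_eq_sum_basis]
              simp only [inner_gradient_left, e]
            simp only [h2, fluxComp, Finset.mul_sum]
            rw [Finset.sum_comm, ← Finset.sum_neg_distrib]
            apply Finset.sum_congr rfl
            intro i _
            rw [← Finset.sum_neg_distrib]
            apply Finset.sum_congr rfl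
            intro k _
            conv_lhs => rw [hx]
            rw [inner_neg_left, real_inner_smul_left]
            ring
          rw [h1, mul_comm b]
          exact mul_le_mul_of_nonneg_left (hflux x y ν ht hd) (norm_nonneg _)
    _ ≤ b * S := by
        rw [integral_const_mul]
        exact mul_le_mul_of_nonneg_left hχ.integral_le hb

end InteriorCalculus

/-! ### The localized energy inequality. -/

section Energy

variable {n m : ℕ} {Ω : Set (EuclideanSpace ℝ (Fin n))}
  {Ψ : (Fin m → ℝ) → ℝ} {Ψ₁ : Fin m → (Fin m → ℝ) → ℝ}
  {Ψ₂ : Fin m → Fin m → (Fin m → ℝ) → ℝ} {lam : Fin m → ℝ}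
  {F : (Fin m → ℝ) → Fin m → ℝ} {α : ℝ} {ρ : Fin m → ℝ} {Tmax : EReal}
  {w : ℝ → EuclideanSpace ℝ (Fin n) → Fin m → ℝ}

lemma cylinder_mono {S S' : Set (EuclideanSpace ℝ (Fin n))} (h : S ⊆ S') :
    cylinder Tmax S ⊆ cylinder Tmax S' := fun _ hq => ⟨hq.1, hq.2.1, h hq.2.2⟩

lemma IsClassicalSolution.continuousOn_uncurry (hw : IsClassicalSolution lam F Ω α ρ Tmax w) :
    ContinuousOn (fun q : ℝ × EuclideanSpace ℝ (Fin n) => w q.1 q.2)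
      (cylinder Tmax (closure Ω)) :=
  continuousOn_pi.2 hw.continuous_closure

lemma IsClassicalSolution.continuousOn_slice (hw : IsClassicalSolution lam F Ω α ρ Tmax w)
    {t : ℝ} (ht : 0 < t) (htT : (t : EReal) < Tmax) : ContinuousOn (w t) (closure Ω) :=
  hw.continuousOn_uncurry.comp (f := fun x => (t, x)) (by fun_prop) fun _ hx => ⟨ht, htT, hx⟩

lemma hasDerivAt_integral_mul_cutoff (hΩo : IsOpen Ω)
    (hw : IsClassicalSolution lam F Ω α ρ Tmax w) (h : IsC2Density Ψ Ψ₁ Ψ₂)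
    {χ : EuclideanSpace ℝ (Fin n) → ℝ} (hχ : Continuous χ) (hc : HasCompactSupport χ)
    (hts : tsupport χ ⊆ Ω) {t : ℝ} (ht : 0 < t) (htT : (t : EReal) < Tmax) :
    HasDerivAt (fun t => ∫ x, Ψ (w t x) * χ x)
      (∫ x, (∑ i, Ψ₁ i (w t x) * deriv (fun s => w s x i) t) * χ x) t := by
  have hopen : {s : ℝ | 0 < s ∧ (s : EReal) < Tmax} ∈ 𝓝 t := by
    refine IsOpen.mem_nhds ?_ ⟨ht, htT⟩
    exact (isOpen_lt continuous_const continuous_id).inter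
      (isOpen_lt continuous_coe_real_ereal continuous_const)
  obtain ⟨η, hη, hsub⟩ := Metric.nhds_basis_closedBall.mem_iff.1 hopen
  have hcont : ContinuousOn (fun q : ℝ × EuclideanSpace ℝ (Fin n) =>
      (∑ i, Ψ₁ i (w q.1 q.2) * deriv (fun s => w s q.2 i) q.1) * χ q.2)
      (cylinder Tmax Ω) := by
    refine ContinuousOn.mul (continuousOn_finsetSum _ fun i _ => ContinuousOn.mul ?_
      (hw.time_deriv_continuous i)) (hχ.comp continuous_snd).continuousOn
    exact (h.contDiff₁ i).continuous.comp_continuousOn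
      (hw.continuousOn_uncurry.mono (cylinder_mono subset_closure))
  -- The time derivative is continuous in the open cylinder only; the compact support of `χ` in `Ω`
  -- supplies the dominating constant.
  have hK : IsCompact (closedBall t η ×ˢ tsupport χ) :=
    (isCompact_closedBall t η).prod hc
  have hKs : closedBall t η ×ˢ tsupport χ ⊆ cylinder Tmax Ω := fun q hq =>
    ⟨(hsub hq.1).1, (hsub hq.1).2, hts hq.2⟩
  obtain ⟨C, hC⟩ := hK.exists_bound_of_continuousOn (hcont.mono hKs)
  have hslice : ∀ s : ℝ, 0 < s → (s : EReal) < Tmax → Continuous fun x => Ψ (w s x) * χ x :=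
    fun s hs hsT => continuous_mul_of_tsupport_subset hΩo
      (h.contDiff.continuous.comp_continuousOn
        ((hw.continuousOn_slice hs hsT).mono subset_closure)) hχ hts
  refine (hasDerivAt_integral_of_dominated_loc_of_deriv_le
    (F' := fun s x => (∑ i, Ψ₁ i (w s x) * deriv (fun s => w s x i) s) * χ x)
    (bound := (tsupport χ).indicator fun _ => C)
    (closedBall_mem_nhds t hη) ?_ ?_ ?_ ?_ ?_ ?_).2
  · filter_upwards [hopen] with s hs
    exact (hslice s hs.1 hs.2).aestronglyMeasurable
  · exact (hslice t ht htT).integrable_of_hasCompactSupport hc.mul_left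
  · refine (continuous_mul_of_tsupport_subset hΩo ?_ hχ hts).aestronglyMeasurable
    refine continuousOn_finsetSum _ fun i _ => ContinuousOn.mul ?_ ?_
    · exact (h.contDiff₁ i).continuous.comp_continuousOn
        ((hw.continuousOn_slice ht htT).mono subset_closure)
    · exact (hw.time_deriv_continuous i).comp (f := fun x => (t, x)) (by fun_prop)
        fun _ hx => ⟨ht, htT, hx⟩
  · refine Eventually.of_forall fun x s hs => ?_
    by_cases hx : x ∈ tsupport χ
    · rw [indicator_of_mem hx]
      exact hC (s, x) ⟨hs, hx⟩
    · rw [indicator_of_notMem hx, image_eq_zero_of_notMem_tsupport hx, mul_zero, norm_zero]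
  · exact (integrable_indicator_iff (isClosed_tsupport χ).measurableSet).2
      (integrableOn_const hc.measure_lt_top.ne)
  · refine Eventually.of_forall fun x s hs => ?_
    by_cases hx : x ∈ tsupport χ
    · apply HasDerivAt.mul_const
      have h1 : HasDerivAt (fun s => w s x) (fun i => deriv (fun s => w s x i) s) s :=
        hasDerivAt_pi.2 fun i => (hw.time_differentiable i (s, x)
          ⟨(hsub hs).1, (hsub hs).2, hts hx⟩).hasDerivAt
      have h2 := (h.hasFDerivAt (w s x)).comp_hasDerivAt s h1
      simp only [sum_apply, smul_apply, ContinuousLinearMap.proj_apply, smul_eq_mul] at h2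
      exact h2
    · simp only [image_eq_zero_of_notMem_tsupport hx, mul_zero]
      exact hasDerivAt_const s 0

/-- Grönwall: `exp (-C t) y - A t` is nonincreasing, since its derivative is at most `A (exp (-C t)
- 1) ≤ 0` for `t ≥ 0`. -/
lemma le_exp_mul_of_deriv_le {y y' : ℝ → ℝ} {A C t₁ t₂ : ℝ} (hA : 0 ≤ A) (hC : 0 ≤ C)
    (ht₁ : 0 ≤ t₁) (h12 : t₁ ≤ t₂) (hy₁ : 0 ≤ y t₁)
    (hy : ∀ t ∈ Icc t₁ t₂, HasDerivAt y (y' t) t)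
    (hle : ∀ t ∈ Icc t₁ t₂, y' t ≤ A + C * y t) :
    y t₂ ≤ Real.exp (C * t₂) * (y t₁ + A * (t₂ - t₁)) := by
  have hd : ∀ t ∈ Icc t₁ t₂, HasDerivAt (fun t => Real.exp (-(C * t)) * y t - A * t)
      (Real.exp (-(C * t)) * (-C) * y t + Real.exp (-(C * t)) * y' t - A) t := by
    intro t ht
    have h1 : HasDerivAt (fun t => -(C * t)) (-C) t := by
      simpa using ((hasDerivAt_id t).const_mul C).fun_neg
    have h2 : HasDerivAt (fun t => A * t) A t := by
      simpa using (hasDerivAt_id t).const_mul A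
    exact (h1.exp.mul (hy t ht)).sub h2
  have hanti : AntitoneOn (fun t => Real.exp (-(C * t)) * y t - A * t) (Icc t₁ t₂) := by
    apply antitoneOn_of_deriv_nonpos (convex_Icc _ _)
      (fun t ht => (hd t ht).continuousAt.continuousWithinAt)
    · intro t ht
      exact (hd t (interior_subset ht)).differentiableAt.differentiableWithinAt
    · intro t ht
      have ht' := interior_subset ht
      rw [(hd t ht').deriv]
      have h1 := hle t ht'
      have h2 : Real.exp (-(C * t)) ≤ 1 := by
        rw [Real.exp_le_one_iff]
        have := mul_nonneg hC (ht₁.trans ht'.1)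
        linarith
      have h3 := mul_le_mul_of_nonneg_left h1 (Real.exp_pos (-(C * t))).le
      have h4 := mul_le_mul_of_nonneg_right h2 hA
      linarith
  have h := hanti (left_mem_Icc.2 h12) (right_mem_Icc.2 h12) h12
  dsimp only at h
  have h1 : Real.exp (-(C * t₁)) ≤ 1 := by
    rw [Real.exp_le_one_iff]
    have := mul_nonneg hC ht₁
    linarith
  have h2 := mul_le_mul_of_nonneg_right h1 hy₁
  have h3 : Real.exp (-(C * t₂)) * y t₂ ≤ y t₁ + A * (t₂ - t₁) := by linarith
  have h4 := mul_le_mul_of_nonneg_left h3 (Real.exp_pos (C * t₂)).le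
  rwa [← mul_assoc, ← Real.exp_add, add_neg_cancel, Real.exp_zero, one_mul] at h4

/-- The structural inequalities for `Ψ` along a solution on the time interval `I`. -/
structure IsLyapunovAlong (Ω : Set (EuclideanSpace ℝ (Fin n))) (lam : Fin m → ℝ)
    (F : (Fin m → ℝ) → Fin m → ℝ)
    (w : ℝ → EuclideanSpace ℝ (Fin n) → Fin m → ℝ)
    (G : Fin m → ℝ → EuclideanSpace ℝ (Fin n) → EuclideanSpace ℝ (Fin n))
    (Ψ : (Fin m → ℝ) → ℝ) (Ψ₁ : Fin m → (Fin m → ℝ) → ℝ)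
    (Ψ₂ : Fin m → Fin m → (Fin m → ℝ) → ℝ) (I : Set ℝ) (A B C : ℝ) : Prop where
  nonneg : ∀ t ∈ I, ∀ x ∈ Ω, 0 ≤ Ψ (w t x)
  hessian : ∀ t ∈ I, ∀ x ∈ Ω, ∀ ξ : Fin m → EuclideanSpace ℝ (Fin n),
    0 ≤ ∑ i, ∑ j, lam i * Ψ₂ i j (w t x) * inner ℝ (ξ i) (ξ j)
  boundary : ∀ t ∈ I, ∀ y ∈ frontier Ω, ∀ ν, IsOutwardNormal Ω y ν →
    ∑ i, lam i * Ψ₁ i (w t y) * inner ℝ (G i t y) ν ≤ B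
  reaction : ∀ t ∈ I, ∀ x ∈ Ω, ∑ i, Ψ₁ i (w t x) * F (w t x) i ≤ A + C * Ψ (w t x)

lemma IsClassicalSolution.continuousOn_laplacian (hw : IsClassicalSolution lam F Ω α ρ Tmax w)
    {t : ℝ} (ht : 0 < t) (htT : (t : EReal) < Tmax) (i : Fin m) :
    ContinuousOn (fun x => Laplacian.laplacian (fun x => w t x i) x) Ω := by
  simp only [laplacian_eq_sum]
  have h := (hw.space_deriv2_continuous i).comp (f := fun x => (t, x)) (s := Ω) (by fun_prop)
    fun _ hx => ⟨ht, htT, hx⟩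
  refine continuousOn_finsetSum _ fun k _ => ?_
  exact (continuous_eval_const (F := ContinuousMultilinearMap ℝ _ ℝ) _).comp_continuousOn h

/-- Inserting the equation into the time derivative splits it into a diffusion part, at most `b *
S`, and a reaction part, at most `A |Ω|` plus `C` times the localized energy. -/
lemma integral_mul_cutoff_le (hΩo : IsOpen Ω) (hΩb : Bornology.IsBounded Ω)
    (hw : IsClassicalSolution lam F Ω α ρ Tmax w) (hF : Continuous F)
    (h : IsC2Density Ψ Ψ₁ Ψ₂)
    {G : Fin m → ℝ → EuclideanSpace ℝ (Fin n) → EuclideanSpace ℝ (Fin n)}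
    {t₁ t₂ A B C b S r : ℝ} (ht₁ : 0 < t₁) (h12 : t₁ ≤ t₂) (ht₂ : (t₂ : EReal) < Tmax)
    (hA : 0 ≤ A) (hC : 0 ≤ C) (hb : 0 ≤ b) (hS : 0 ≤ S)
    (hL : IsLyapunovAlong Ω lam F w G Ψ Ψ₁ Ψ₂ (Icc t₁ t₂) A B C)
    {χ : EuclideanSpace ℝ (Fin n) → ℝ} (hχ : IsBoundaryCutoff Ω S r χ)
    (hflux : ∀ t ∈ Icc t₁ t₂, ∀ x y ν, TouchesAt Ω x y ν → dist x y ≤ r →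
      ∑ i, lam i * Ψ₁ i (w t x) * inner ℝ (gradient (fun x => w t x i) x) ν ≤ b) :
    ∫ x, Ψ (w t₂ x) * χ x ≤ Real.exp (C * t₂) *
      ((∫ x, Ψ (w t₁ x) * χ x) + (b * S + A * volume.real Ω) * (t₂ - t₁)) := by
  obtain ⟨D, hD⟩ := hχ.lipschitz
  have hχc := hD.continuous
  have hpos : ∀ t ∈ Icc t₁ t₂, 0 < t := fun t ht => ht₁.trans_le ht.1
  have hlt : ∀ t ∈ Icc t₁ t₂, (t : EReal) < Tmax := fun t ht =>
    (EReal.coe_le_coe_iff.2 ht.2).trans_lt ht₂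
  have hzero : ∀ x, x ∉ Ω → χ x = 0 := fun x hx =>
    image_eq_zero_of_notMem_tsupport fun h => hx (hχ.tsupport_subset h)
  refine le_exp_mul_of_deriv_le (A := b * S + A * volume.real Ω) (by positivity) hC ht₁.le h12 ?_
    (fun t ht => hasDerivAt_integral_mul_cutoff hΩo hw h hχc hχ.compact hχ.tsupport_subset
      (hpos t ht) (hlt t ht)) fun t ht => ?_
  · refine integral_nonneg fun x => ?_
    by_cases hx : x ∈ Ω
    · exact mul_nonneg (hL.nonneg t₁ (left_mem_Icc.2 h12) x hx) (hχ.nonneg x)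
    · simp [hzero x hx]
  have ht0 := hpos t ht
  have htT := hlt t ht
  have hwt : ContinuousOn (w t) Ω := (hw.continuousOn_slice ht0 htT).mono subset_closure
  have hc1 : ContinuousOn
      (fun x => ∑ i, lam i * Ψ₁ i (w t x) * Laplacian.laplacian (fun x => w t x i) x) Ω :=
    continuousOn_finsetSum _ fun i _ => (continuousOn_const.mul
      ((h.contDiff₁ i).continuous.comp_continuousOn hwt)).mul
        (hw.continuousOn_laplacian ht0 htT i)
  have hc2 : ContinuousOn (fun x => ∑ i, Ψ₁ i (w t x) * F (w t x) i) Ω :=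
    continuousOn_finsetSum _ fun i _ => ((h.contDiff₁ i).continuous.comp_continuousOn hwt).mul
      (((continuous_apply i).comp hF).comp_continuousOn hwt)
  have hc3 : ContinuousOn (fun x => Ψ (w t x)) Ω := h.contDiff.continuous.comp_continuousOn hwt
  have hinteg : ∀ {f : EuclideanSpace ℝ (Fin n) → ℝ}, ContinuousOn f Ω →
      Integrable fun x => f x * χ x := fun hf =>
    integrable_mul_of_tsupport_subset hΩo hf hχc hχ.compact hχ.tsupport_subset
  have hstep1 : ∫ x, (∑ i, Ψ₁ i (w t x) * deriv (fun s => w s x i) t) * χ x =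
      ∫ x, ((∑ i, lam i * Ψ₁ i (w t x) * Laplacian.laplacian (fun x => w t x i) x) * χ x +
        (∑ i, Ψ₁ i (w t x) * F (w t x) i) * χ x) := by
    refine integral_congr_ae (Eventually.of_forall fun x => ?_)
    dsimp only
    by_cases hx : x ∈ Ω
    · rw [← add_mul, ← Finset.sum_add_distrib]
      congr 1
      refine Finset.sum_congr rfl fun i _ => ?_
      have := hw.equation i (t, x) ⟨ht0, htT, hx⟩
      dsimp only at this
      rw [← this]
      ring
    · simp [hzero x hx]
  have hstep2 : ∫ x, (∑ i, Ψ₁ i (w t x) * F (w t x) i) * χ x ≤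
      A * volume.real Ω + C * ∫ x, Ψ (w t x) * χ x := by
    have hχi : Integrable χ := hχc.integrable_of_hasCompactSupport hχ.compact
    calc ∫ x, (∑ i, Ψ₁ i (w t x) * F (w t x) i) * χ x
        ≤ ∫ x, (A * χ x + C * (Ψ (w t x) * χ x)) := by
          refine integral_mono (hinteg hc2) ((hχi.const_mul A).add ((hinteg hc3).const_mul C))
            fun x => ?_
          dsimp only
          by_cases hx : x ∈ Ω
          · have := mul_le_mul_of_nonneg_right (hL.reaction t ht x hx) (hχ.nonneg x)
            linarith
          · simp [hzero x hx]
      _ = A * (∫ x, χ x) + C * ∫ x, Ψ (w t x) * χ x := by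
          rw [integral_add (hχi.const_mul A) ((hinteg hc3).const_mul C), integral_const_mul,
            integral_const_mul]
      _ ≤ _ := by
          gcongr
          calc ∫ x, χ x = ∫ x in Ω, χ x := by
                rw [setIntegral_eq_integral_of_forall_compl_eq_zero hzero]
            _ ≤ ∫ x in Ω, (1 : ℝ) := by
                refine integral_mono hχi.integrableOn ?_ hχ.le_one
                exact integrableOn_const hΩb.measure_lt_top.ne
            _ = volume.real Ω := by simp
  rw [hstep1, integral_add (hinteg hc1) (hinteg hc2)]
  have hstep3 := integral_laplacian_mul_cutoff_le hΩo h
    (fun i => hw.space_contDiff i t ht0 htT) hb hχ (hflux t ht)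
    (fun x hx => hL.hessian t ht x hx _) hc1
  linarith

end Energy

/-! ### Removing the cutoff and reaching the initial time. -/

section EnergyLimit

variable {n m : ℕ} {Ω : Set (EuclideanSpace ℝ (Fin n))}
  {Ψ : (Fin m → ℝ) → ℝ} {Ψ₁ : Fin m → (Fin m → ℝ) → ℝ}
  {Ψ₂ : Fin m → Fin m → (Fin m → ℝ) → ℝ} {lam : Fin m → ℝ}
  {F : (Fin m → ℝ) → Fin m → ℝ} {α : ℝ} {ρ : Fin m → ℝ} {Tmax : EReal}
  {w : ℝ → EuclideanSpace ℝ (Fin n) → Fin m → ℝ}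
  {G : Fin m → ℝ → EuclideanSpace ℝ (Fin n) → EuclideanSpace ℝ (Fin n)}

lemma IsClassicalSolution.integrableOn_comp (hΩb : Bornology.IsBounded Ω)
    (hw : IsClassicalSolution lam F Ω α ρ Tmax w) (hΨ : Continuous Ψ)
    {t : ℝ} (ht : 0 < t) (htT : (t : EReal) < Tmax) :
    IntegrableOn (fun x => Ψ (w t x)) Ω :=
  ((hΨ.comp_continuousOn (hw.continuousOn_slice ht htT)).integrableOn_compact
    hΩb.isCompact_closure).mono_set subset_closure

/-- The vector field `∑ λ_i Ψ₁ i (w) G_i` is uniformly continuous on the compact space-time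
cylinder, so its component along `ν` at `x` differs by less than `δ` from that at the touching point
`y`, where the same `ν` is the outward normal. -/
lemma exists_flux_le (hΩb : Bornology.IsBounded Ω) (hΩo : IsOpen Ω) (hΩ : HasC1Boundary Ω)
    (hw : IsClassicalSolution lam F Ω α ρ Tmax w) (h : IsC2Density Ψ Ψ₁ Ψ₂)
    (hG : ∀ i, ContinuousOn (fun q : ℝ × EuclideanSpace ℝ (Fin n) => G i q.1 q.2)
      (cylinder Tmax (closure Ω)))
    (hGw : ∀ i, ∀ q ∈ cylinder Tmax Ω, G i q.1 q.2 = gradient (fun x => w q.1 x i) q.2)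
    {t₁ t₂ A B C δ : ℝ} (ht₁ : 0 < t₁) (ht₂ : (t₂ : EReal) < Tmax)
    (hL : IsLyapunovAlong Ω lam F w G Ψ Ψ₁ Ψ₂ (Icc t₁ t₂) A B C) (hδ : 0 < δ) :
    ∃ r₀ > 0, ∀ t ∈ Icc t₁ t₂, ∀ x y ν, TouchesAt Ω x y ν → dist x y < r₀ →
      ∑ i, lam i * Ψ₁ i (w t x) * inner ℝ (gradient (fun x => w t x i) x) ν ≤ B + δ := by
  have hK : IsCompact (Icc t₁ t₂ ×ˢ closure Ω) := isCompact_Icc.prod hΩb.isCompact_closure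
  have hsub : Icc t₁ t₂ ×ˢ closure Ω ⊆ cylinder Tmax (closure Ω) := fun q hq =>
    ⟨ht₁.trans_le hq.1.1, (EReal.coe_le_coe_iff.2 hq.1.2).trans_lt ht₂, hq.2⟩
  have hV : ContinuousOn (fun q : ℝ × EuclideanSpace ℝ (Fin n) =>
      ∑ i, (lam i * Ψ₁ i (w q.1 q.2)) • G i q.1 q.2) (Icc t₁ t₂ ×ˢ closure Ω) :=
    continuousOn_finsetSum _ fun i _ => (continuousOn_const.mul
      ((h.contDiff₁ i).continuous.comp_continuousOn (hw.continuousOn_uncurry.mono hsub))).smul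
        ((hG i).mono hsub)
  obtain ⟨r₀, hr₀, hu⟩ := Metric.uniformContinuousOn_iff.1
    (hK.uniformContinuousOn_of_continuous hV) δ hδ
  refine ⟨r₀, hr₀, fun t ht x y ν htch hd => ?_⟩
  have hyc : y ∈ closure Ω := frontier_subset_closure htch.mem_frontier
  have h1 := hu (t, x) ⟨ht, subset_closure htch.mem⟩ (t, y) ⟨ht, hyc⟩ (by simpa [Prod.dist_eq])
  rw [dist_eq_norm] at h1
  have h2 := hL.boundary t ht y htch.mem_frontier ν (htch.isOutwardNormal hΩo hΩ)
  have h3 := real_inner_le_norm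
    ((∑ i, (lam i * Ψ₁ i (w t x)) • G i t x) - ∑ i, (lam i * Ψ₁ i (w t y)) • G i t y) ν
  rw [htch.norm_eq_one, mul_one, inner_sub_left, sum_inner, sum_inner] at h3
  simp only [real_inner_smul_left] at h3
  have h4 : ∀ i, G i t x = gradient (fun x => w t x i) x := fun i =>
    hGw i (t, x) ⟨ht₁.trans_le ht.1, (EReal.coe_le_coe_iff.2 ht.2).trans_lt ht₂, htch.mem⟩
  simp only [h4] at h3
  dsimp only at h1
  simp only [h4] at h1
  linarith

/-- The layer width is chosen after the tolerance `1 / (k + 1)` for the flux. This is harmless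
because `S` is the same for all widths; then `k → ∞` by dominated convergence. -/
theorem integral_le_of_isLyapunovAlong (hn : 0 < n) (hΩo : IsOpen Ω)
    (hΩb : Bornology.IsBounded Ω) (hΩ : HasC1Boundary Ω)
    (hw : IsClassicalSolution lam F Ω α ρ Tmax w) (hF : Continuous F)
    (h : IsC2Density Ψ Ψ₁ Ψ₂)
    (hG : ∀ i, ContinuousOn (fun q : ℝ × EuclideanSpace ℝ (Fin n) => G i q.1 q.2)
      (cylinder Tmax (closure Ω)))
    (hGw : ∀ i, ∀ q ∈ cylinder Tmax Ω, G i q.1 q.2 = gradient (fun x => w q.1 x i) q.2)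
    {t₁ t₂ A B C S : ℝ} (ht₁ : 0 < t₁) (h12 : t₁ ≤ t₂) (ht₂ : (t₂ : EReal) < Tmax)
    (hA : 0 ≤ A) (hB : 0 ≤ B) (hC : 0 ≤ C) (hS : 0 ≤ S)
    (hcut : ∀ r : ℝ, 0 < r → ∃ χ, IsBoundaryCutoff Ω S r χ)
    (hL : IsLyapunovAlong Ω lam F w G Ψ Ψ₁ Ψ₂ (Icc t₁ t₂) A B C) :
    ∫ x in Ω, Ψ (w t₂ x) ≤ Real.exp (C * t₂) *
      ((∫ x in Ω, Ψ (w t₁ x)) + (B * S + A * volume.real Ω) * (t₂ - t₁)) := by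
  have hΨc := h.contDiff.continuous
  have ht₁T : (t₁ : EReal) < Tmax := (EReal.coe_le_coe_iff.2 h12).trans_lt ht₂
  have hi1 := hw.integrableOn_comp hΩb hΨc ht₁ ht₁T
  have hi2 := hw.integrableOn_comp hΩb hΨc (ht₁.trans_le h12) ht₂
  have key : ∀ k : ℕ, ∃ χ : EuclideanSpace ℝ (Fin n) → ℝ, Continuous χ ∧ (∀ x, 0 ≤ χ x) ∧
      (∀ x, χ x ≤ 1) ∧ (∀ x, 1 / ((k : ℝ) + 1) ≤ infDist x Ωᶜ → χ x = 1) ∧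
      ∫ x in Ω, Ψ (w t₂ x) * χ x ≤ Real.exp (C * t₂) * ((∫ x in Ω, Ψ (w t₁ x)) +
        ((B + 1 / ((k : ℝ) + 1)) * S + A * volume.real Ω) * (t₂ - t₁)) := by
    intro k
    have hk : 0 < 1 / ((k : ℝ) + 1) := by positivity
    obtain ⟨r₀, hr₀, hfl⟩ := exists_flux_le hΩb hΩo hΩ hw h hG hGw ht₁ ht₂ hL hk
    obtain ⟨χ, hχ⟩ := hcut (min (r₀ / 2) (1 / ((k : ℝ) + 1))) (by positivity)
    obtain ⟨D, hD⟩ := hχ.lipschitz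
    have hzero : ∀ x, x ∉ Ω → χ x = 0 := fun x hx =>
      image_eq_zero_of_notMem_tsupport fun h => hx (hχ.tsupport_subset h)
    refine ⟨χ, hD.continuous, hχ.nonneg, hχ.le_one,
      fun x hx => hχ.eq_one x ((min_le_right _ _).trans hx), ?_⟩
    have hmain := integral_mul_cutoff_le hΩo hΩb hw hF h ht₁ h12 ht₂ hA hC
      (b := B + 1 / ((k : ℝ) + 1)) (by positivity) hS hL hχ
      (fun t ht x y ν htch hd => hfl t ht x y ν htch
        (hd.trans_lt ((min_le_left _ _).trans_lt (by linarith))))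
    rw [setIntegral_eq_integral_of_forall_compl_eq_zero fun x hx => by rw [hzero x hx, mul_zero]]
    refine hmain.trans ?_
    gcongr
    rw [← setIntegral_eq_integral_of_forall_compl_eq_zero (s := Ω)
      fun x hx => by rw [hzero x hx, mul_zero]]
    refine setIntegral_mono_on ?_ hi1 hΩo.measurableSet fun x hx =>
      mul_le_of_le_one_right (hL.nonneg t₁ (left_mem_Icc.2 h12) x hx) (hχ.le_one x)
    refine hi1.mul_bdd (c := 1) hD.continuous.aestronglyMeasurable (Eventually.of_forall fun x => ?_)
    rw [Real.norm_of_nonneg (hχ.nonneg x)]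
    exact hχ.le_one x
  choose χ hχc hχ0 hχ1 hχe hle using key
  have hlim1 : Tendsto (fun k => ∫ x in Ω, Ψ (w t₂ x) * χ k x) atTop
      (𝓝 (∫ x in Ω, Ψ (w t₂ x))) := by
    refine tendsto_integral_of_dominated_convergence (fun x => ‖Ψ (w t₂ x)‖)
      (fun k => hi2.1.mul (hχc k).aestronglyMeasurable) hi2.norm
      (fun k => Eventually.of_forall fun x => ?_) ?_
    · rw [norm_mul, Real.norm_of_nonneg (hχ0 k x)]
      exact mul_le_of_le_one_right (norm_nonneg _) (hχ1 k x)
    · refine (ae_restrict_iff' hΩo.measurableSet).2 (Eventually.of_forall fun x hx => ?_)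
      obtain ⟨y, hy, htch⟩ := exists_touchesAt hn hΩo hΩb hx
      have hpos : 0 < infDist x Ωᶜ := by rw [hy]; exact dist_pos.2 htch.ne
      refine tendsto_const_nhds.congr' ?_
      filter_upwards [(tendsto_one_div_add_atTop_nhds_zero_nat (𝕜 := ℝ)).eventually
        (gt_mem_nhds hpos)] with k hk
      rw [hχe k x hk.le, mul_one]
  have hlim2 : Tendsto (fun k : ℕ => Real.exp (C * t₂) * ((∫ x in Ω, Ψ (w t₁ x)) +
        ((B + 1 / ((k : ℝ) + 1)) * S + A * volume.real Ω) * (t₂ - t₁))) atTop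
      (𝓝 (Real.exp (C * t₂) * ((∫ x in Ω, Ψ (w t₁ x)) +
        ((B + 0) * S + A * volume.real Ω) * (t₂ - t₁)))) :=
    ((((((tendsto_one_div_add_atTop_nhds_zero_nat (𝕜 := ℝ)).const_add B).mul_const S).add_const
      _).mul_const _).const_add _).const_mul _
  rw [add_zero] at hlim2
  exact le_of_tendsto_of_tendsto' hlim1 hlim2 hle

lemma IsClassicalSolution.exists_initial_bound (hw : IsClassicalSolution lam F Ω α ρ Tmax w) :
    ∃ R : ℝ, ∀ᵐ x ∂(volume.restrict Ω), ∀ i, |w 0 x i| ≤ R := by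
  have h1 : ∀ i, ∃ R : ℝ, ∀ᵐ x ∂(volume.restrict Ω), |w 0 x i| ≤ R := by
    intro i
    have h := hw.initial_memLp i
    refine ⟨(eLpNorm (fun x => w 0 x i) ⊤ (volume.restrict Ω)).toReal, ?_⟩
    rw [eLpNorm_exponent_top]
    have h2 := ae_le_eLpNormEssSup (f := fun x => w 0 x i) (μ := volume.restrict Ω)
    filter_upwards [h2] with x hx
    have hfin : eLpNormEssSup (fun x => w 0 x i) (volume.restrict Ω) ≠ ⊤ := by
      have := h.2.ne
      rwa [eLpNorm_exponent_top] at this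
    have := ENNReal.toReal_mono hfin hx
    simpa using this
  choose R hR using h1
  refine ⟨∑ i, |R i|, ?_⟩
  filter_upwards [ae_all_iff.2 hR] with x hx i
  exact (hx i).trans ((le_abs_self _).trans
    (Finset.single_le_sum (f := fun i => |R i|) (fun i _ => abs_nonneg _) (Finset.mem_univ i)))

lemma IsClassicalSolution.aestronglyMeasurable_initial
    (hw : IsClassicalSolution lam F Ω α ρ Tmax w) :
    AEStronglyMeasurable (w 0) (volume.restrict Ω) := by
  apply AEMeasurable.aestronglyMeasurable
  exact aemeasurable_pi_lambda _ fun i => (hw.initial_memLp i).1.aemeasurable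

lemma IsClassicalSolution.integrableOn_comp_initial (hΩb : Bornology.IsBounded Ω)
    (hw : IsClassicalSolution lam F Ω α ρ Tmax w) (hΨ : Continuous Ψ) :
    IntegrableOn (fun x => Ψ (w 0 x)) Ω := by
  obtain ⟨R, hR⟩ := hw.exists_initial_bound
  obtain ⟨D, hD⟩ := (isCompact_closedBall (0 : Fin m → ℝ) |R|).exists_bound_of_continuousOn
    hΨ.continuousOn
  have : IsFiniteMeasure (volume.restrict Ω) := ⟨by simpa using hΩb.measure_lt_top⟩
  refine Integrable.of_bound (hΨ.comp_aestronglyMeasurable hw.aestronglyMeasurable_initial) D ?_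
  filter_upwards [hR] with x hx
  apply hD
  rw [mem_closedBall_zero_iff, pi_norm_le_iff_of_nonneg (abs_nonneg R)]
  exact fun i => (hx i).trans (le_abs_self R)

/-- All values near time zero lie in one ball, on which `Ψ` is Lipschitz, so convergence of `w` in
`L¹` passes to the integrals of `Ψ (w)`. -/
lemma tendsto_integral_initial (hΩo : IsOpen Ω) (hΩb : Bornology.IsBounded Ω) (hT : 0 < Tmax)
    (hw : IsClassicalSolution lam F Ω α ρ Tmax w) (hΨ : ContDiff ℝ 1 Ψ) :
    Tendsto (fun t => ∫ x in Ω, Ψ (w t x)) (𝓝[>] 0) (𝓝 (∫ x in Ω, Ψ (w 0 x))) := by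
  obtain ⟨T, hT0, hTT⟩ : ∃ T : ℝ, 0 < T ∧ (T : EReal) < Tmax := by
    obtain ⟨q, hq0, hq⟩ := EReal.lt_iff_exists_real_btwn.1 hT
    exact ⟨q, by exact_mod_cast hq0, hq⟩
  obtain ⟨R₁, hR₁⟩ := hw.locally_bounded T hTT
  obtain ⟨R₀, hR₀⟩ := hw.exists_initial_bound
  set R := |R₀| + |R₁| with hR
  have hRR₀ : R₀ ≤ R := by have := le_abs_self R₀; have := abs_nonneg R₁; linarith
  have hRR₁ : R₁ ≤ R := by have := le_abs_self R₁; have := abs_nonneg R₀; linarith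
  have hRnn : 0 ≤ R := by positivity
  obtain ⟨L, hL⟩ := LocallyLipschitzOn.exists_lipschitzOnWith_of_compact
    (isCompact_closedBall (0 : Fin m → ℝ) R)
    ((hΨ.locallyLipschitz).locallyLipschitzOn (s := closedBall (0 : Fin m → ℝ) R))
  have hmem : ∀ v : Fin m → ℝ, (∀ i, |v i| ≤ R) → v ∈ closedBall (0 : Fin m → ℝ) R := by
    intro v hv
    rw [mem_closedBall_zero_iff, pi_norm_le_iff_of_nonneg hRnn]
    exact hv
  have hi0 := hw.integrableOn_comp_initial hΩb hΨ.continuous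
  have hbound : ∀ t ∈ Ioc 0 T, ‖(∫ x in Ω, Ψ (w t x)) - ∫ x in Ω, Ψ (w 0 x)‖ ≤
      L * ∑ i, ∫ x in Ω, |w t x i - w 0 x i| := by
    intro t ht
    have htT : (t : EReal) < Tmax := (EReal.coe_le_coe_iff.2 ht.2).trans_lt hTT
    have hi := hw.integrableOn_comp hΩb hΨ.continuous ht.1 htT
    have hij : ∀ i, IntegrableOn (fun x => |w t x i - w 0 x i|) Ω := fun i =>
      ((hw.integrableOn_comp hΩb (continuous_apply i) ht.1 htT).sub
        (hw.integrableOn_comp_initial hΩb (continuous_apply i))).abs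
    rw [← integral_sub hi hi0, ← integral_finsetSum _ fun i _ => hij i, ← integral_const_mul]
    refine (norm_integral_le_integral_norm _).trans ?_
    refine integral_mono_ae (hi.sub hi0).norm
      ((integrable_finsetSum _ fun i _ => hij i).const_mul _) ?_
    filter_upwards [hR₀, ae_restrict_mem hΩo.measurableSet] with x hx0 hx
    have h1 := hL.dist_le_mul (w t x) (hmem _ fun i => (hR₁ t ht x hx i).trans hRR₁)
      (w 0 x) (hmem _ fun i => (hx0 i).trans hRR₀)
    rw [dist_eq_norm, dist_eq_norm] at h1
    refine h1.trans (mul_le_mul_of_nonneg_left ?_ L.2)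
    rw [pi_norm_le_iff_of_nonneg (Finset.sum_nonneg fun i _ => abs_nonneg _)]
    intro i
    exact Finset.single_le_sum (f := fun i => |w t x i - w 0 x i|) (fun i _ => abs_nonneg _)
      (Finset.mem_univ i)
  have hlim : Tendsto (fun t => (L : ℝ) * ∑ i, ∫ x in Ω, |w t x i - w 0 x i|) (𝓝[>] 0) (𝓝 0) := by
    have := (tendsto_finsetSum Finset.univ fun i _ => hw.initial_attained i).const_mul (L : ℝ)
    simpa using this
  rw [tendsto_iff_norm_sub_tendsto_zero]
  refine squeeze_zero' (Eventually.of_forall fun t => norm_nonneg _) ?_ hlim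
  filter_upwards [Ioc_mem_nhdsGT hT0] with t ht using hbound t ht

theorem integral_le_initial_of_isLyapunovAlong (hn : 0 < n) (hΩo : IsOpen Ω)
    (hΩb : Bornology.IsBounded Ω) (hΩ : HasC1Boundary Ω)
    (hw : IsClassicalSolution lam F Ω α ρ Tmax w) (hF : Continuous F)
    (h : IsC2Density Ψ Ψ₁ Ψ₂)
    (hG : ∀ i, ContinuousOn (fun q : ℝ × EuclideanSpace ℝ (Fin n) => G i q.1 q.2)
      (cylinder Tmax (closure Ω)))
    (hGw : ∀ i, ∀ q ∈ cylinder Tmax Ω, G i q.1 q.2 = gradient (fun x => w q.1 x i) q.2)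
    {t A B C S : ℝ} (ht : 0 < t) (htT : (t : EReal) < Tmax)
    (hA : 0 ≤ A) (hB : 0 ≤ B) (hC : 0 ≤ C) (hS : 0 ≤ S)
    (hcut : ∀ r : ℝ, 0 < r → ∃ χ, IsBoundaryCutoff Ω S r χ)
    (hL : IsLyapunovAlong Ω lam F w G Ψ Ψ₁ Ψ₂ (Ioc 0 t) A B C) :
    ∫ x in Ω, Ψ (w t x) ≤ Real.exp (C * t) *
      ((∫ x in Ω, Ψ (w 0 x)) + (B * S + A * volume.real Ω) * t) := by
  have hT : 0 < Tmax := lt_trans (by exact_mod_cast ht) htT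
  have h1 := tendsto_integral_initial hΩo hΩb hT hw h.contDiff
  have h2 : Tendsto (fun s : ℝ => t - s) (𝓝[>] 0) (𝓝 (t - 0)) :=
    ((continuous_const.sub continuous_id).tendsto 0).mono_left nhdsWithin_le_nhds
  have h3 := (h1.add (h2.const_mul (B * S + A * volume.real Ω))).const_mul (Real.exp (C * t))
  rw [sub_zero] at h3
  -- The estimate from time `s` to time `t` has constants independent of `s`, so `s ↓ 0` is allowed.
  refine ge_of_tendsto h3 ?_
  filter_upwards [Ioc_mem_nhdsGT ht] with s hs
  have hsub : Icc s t ⊆ Ioc 0 t := fun r hr => ⟨hs.1.trans_le hr.1, hr.2⟩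
  exact integral_le_of_isLyapunovAlong hn hΩo hΩb hΩ hw hF h hG hGw hs.1 hs.2 htT hA hB hC hS hcut
    ⟨fun r hr => hL.nonneg r (hsub hr), fun r hr => hL.hessian r (hsub hr),
      fun r hr => hL.boundary r (hsub hr), fun r hr => hL.reaction r (hsub hr)⟩

end EnergyLimit

/-! ### Nonnegativity of solutions and the sign of the normal derivative at zeros. -/

section Nonneg

lemma hasDerivAt_max_zero_pow (k : ℕ) (s : ℝ) :
    HasDerivAt (fun s : ℝ => max s 0 ^ (k + 2)) (((k : ℝ) + 2) * max s 0 ^ (k + 1)) s := by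
  have hpow : HasDerivAt (fun s : ℝ => s ^ (k + 2)) (((k : ℝ) + 2) * s ^ (k + 1)) s := by
    simpa using hasDerivAt_pow (k + 2) s
  rcases lt_trichotomy s 0 with hs | hs | hs
  · rw [max_eq_right hs.le, zero_pow (by omega), mul_zero]
    refine (hasDerivAt_const s (0 : ℝ)).congr_of_eventuallyEq ?_
    filter_upwards [gt_mem_nhds hs] with r hr
    rw [max_eq_right hr.le, zero_pow (by omega)]
  · subst hs
    rw [max_self, ← hasDerivWithinAt_univ, ← Iic_union_Ici (a := (0 : ℝ))]
    refine HasDerivWithinAt.union ?_ ?_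
    · rw [zero_pow (by omega), mul_zero]
      refine (hasDerivWithinAt_const (0 : ℝ) (Iic 0) (0 : ℝ)).congr (fun r hr => ?_) ?_
      · rw [max_eq_right hr, zero_pow (by omega)]
      · rw [max_self, zero_pow (by omega)]
    · refine hpow.hasDerivWithinAt.congr (fun r hr => ?_) ?_
      · rw [max_eq_left hr]
      · rw [max_self]
  · rw [max_eq_left hs.le]
    refine hpow.congr_of_eventuallyEq ?_
    filter_upwards [lt_mem_nhds hs] with r hr
    rw [max_eq_left hr.le]

variable {n m : ℕ}

lemma hasFDerivAt_negPart_pow (k : ℕ) (i : Fin m) (w : Fin m → ℝ) :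
    HasFDerivAt (fun w : Fin m → ℝ => max (-w i) 0 ^ (k + 2))
      ((-(((k : ℝ) + 2) * max (-w i) 0 ^ (k + 1))) •
        ContinuousLinearMap.proj (R := ℝ) (φ := fun _ : Fin m => ℝ) i) w := by
  have h1 : HasFDerivAt (fun w : Fin m → ℝ => -w i)
      (-ContinuousLinearMap.proj (R := ℝ) (φ := fun _ : Fin m => ℝ) i) w :=
    (hasFDerivAt_apply i w).fun_neg
  have h2 := (hasDerivAt_max_zero_pow k (-w i)).comp_hasFDerivAt w h1
  rw [smul_neg, ← neg_smul] at h2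
  exact h2

/-- The cube is the lowest integer power of the negative part that is `C²`. -/
lemma isC2Density_negPart : IsC2Density (fun w : Fin m → ℝ => ∑ i, max (-w i) 0 ^ 3)
    (fun i w => -(3 * max (-w i) 0 ^ 2))
    (fun i j w => if j = i then 6 * max (-w i) 0 else 0) := by
  refine ⟨fun w => ?_, fun i w => ?_, fun i j => ?_⟩
  · have := HasFDerivAt.fun_sum (u := Finset.univ)
      fun (i : Fin m) _ => hasFDerivAt_negPart_pow 1 i w
    norm_num at this ⊢
    exact this
  · have := ((hasFDerivAt_negPart_pow 0 i w).const_mul 3).fun_neg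
    simp only [ite_smul, zero_smul, Finset.sum_ite_eq', Finset.mem_univ, if_true]
    refine this.congr_fderiv ?_
    rw [smul_smul, ← neg_smul]
    congr 1
    push_cast
    ring
  · split_ifs <;> fun_prop

variable {Ω : Set (EuclideanSpace ℝ (Fin n))} {lam : Fin m → ℝ}
  {F : (Fin m → ℝ) → Fin m → ℝ} {α : ℝ} {ρ : Fin m → ℝ} {Tmax : EReal}
  {w : ℝ → EuclideanSpace ℝ (Fin n) → Fin m → ℝ}

/-- Where `w i < 0`, the vector `w⁺` has `i`-th component zero, so quasi-positivity and the local
Lipschitz bound give `F w i ≥ -L ‖w - w⁺‖`, and that distance is the largest negative part `γ`. -/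
lemma exists_negPart_reaction_le (hF : SmoothQuasiPositive F) (R : ℝ) :
    ∃ C : ℝ, 0 ≤ C ∧ ∀ w : Fin m → ℝ, (∀ i, |w i| ≤ R) →
      ∑ i, -(3 * max (-w i) 0 ^ 2) * F w i ≤ C * ∑ i, max (-w i) 0 ^ 3 := by
  obtain ⟨L, hL⟩ := LocallyLipschitzOn.exists_lipschitzOnWith_of_compact
    (isCompact_closedBall (0 : Fin m → ℝ) |R|)
    (hF.locallyLipschitz.locallyLipschitzOn (s := closedBall (0 : Fin m → ℝ) |R|))
  refine ⟨∑ _i : Fin m, 3 * (L : ℝ), by positivity, fun w hw => ?_⟩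
  rw [Finset.sum_mul]
  refine Finset.sum_le_sum fun i _ => ?_
  obtain ⟨j, -, hj⟩ := Finset.exists_max_image Finset.univ (fun j => max (-w j) 0)
    ⟨i, Finset.mem_univ i⟩
  set γ := max (-w j) 0 with hγ
  have hγ0 : 0 ≤ γ := le_max_right _ _
  have hγ3 : γ ^ 3 ≤ ∑ i, max (-w i) 0 ^ 3 :=
    Finset.single_le_sum (f := fun i => max (-w i) 0 ^ 3)
      (fun i _ => pow_nonneg (le_max_right _ _) 3) (Finset.mem_univ j)
  have hgi : max (-w i) 0 ≤ γ := hj i (Finset.mem_univ i)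
  have hL0 : (0 : ℝ) ≤ L := L.2
  have hLγ : (3 * (L : ℝ)) * γ ^ 3 ≤ 3 * (L : ℝ) * ∑ i, max (-w i) 0 ^ 3 :=
    mul_le_mul_of_nonneg_left hγ3 (by positivity)
  refine le_trans ?_ hLγ
  by_cases hi : 0 ≤ w i
  · rw [max_eq_right (by linarith)]
    have : 0 ≤ 3 * (L : ℝ) * γ ^ 3 := by positivity
    simpa using this
  rw [not_le] at hi
  set v : Fin m → ℝ := fun k => max (w k) 0 with hv
  have hvw : ‖w - v‖ ≤ γ := by
    rw [pi_norm_le_iff_of_nonneg hγ0]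
    intro k
    have h1 := hj k (Finset.mem_univ k)
    refine le_trans (le_of_eq ?_) h1
    simp only [Pi.sub_apply, hv, Real.norm_eq_abs]
    rcases le_total 0 (w k) with h | h
    · rw [max_eq_left h, max_eq_right (by linarith)]; simp
    · rw [max_eq_right h, max_eq_left (by linarith), sub_zero, abs_of_nonpos h]
  have hwm : w ∈ closedBall (0 : Fin m → ℝ) |R| := by
    rw [mem_closedBall_zero_iff, pi_norm_le_iff_of_nonneg (abs_nonneg R)]
    exact fun k => (hw k).trans (le_abs_self R)
  have hvm : v ∈ closedBall (0 : Fin m → ℝ) |R| := by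
    rw [mem_closedBall_zero_iff, pi_norm_le_iff_of_nonneg (abs_nonneg R)]
    intro k
    refine le_trans ?_ ((hw k).trans (le_abs_self R))
    simp only [hv, Real.norm_eq_abs]
    rcases le_total 0 (w k) with h | h
    · rw [max_eq_left h]
    · rw [max_eq_right h, abs_zero]; exact abs_nonneg _
  have h1 := hL.dist_le_mul w hwm v hvm
  rw [dist_eq_norm, dist_eq_norm] at h1
  have h2 : |F w i - F v i| ≤ L * γ :=
    (norm_le_pi_norm (F w - F v) i).trans (h1.trans (mul_le_mul_of_nonneg_left hvw hL0))
  have h3 : 0 ≤ F v i := hF.quasiPositive i v (fun k => le_max_right _ _) (max_eq_right hi.le)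
  have h4 : -F w i ≤ L * γ := by have := (abs_le.1 h2).1; linarith
  have h5 : 0 ≤ max (-w i) 0 := le_max_right _ _
  have h6 : max (-w i) 0 ^ 2 ≤ γ ^ 2 := pow_le_pow_left₀ h5 hgi 2
  calc -(3 * max (-w i) 0 ^ 2) * F w i = 3 * max (-w i) 0 ^ 2 * -F w i := by ring
    _ ≤ 3 * max (-w i) 0 ^ 2 * (L * γ) := mul_le_mul_of_nonneg_left h4 (by positivity)
    _ ≤ 3 * γ ^ 2 * (L * γ) := by gcongr
    _ = 3 * L * γ ^ 3 := by ring

/-- Where `s < 0`, the Robin condition forces `(1 - α) g = ρ i - α s ≥ 0`, the Neumann condition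
gives `g = 0`, and the Dirichlet condition is impossible. -/
lemma negPart_flux_nonpos (hρ : AdmissibleBoundaryData α ρ) {i : Fin m} {s g : ℝ}
    (h : α * s + (1 - α) * g = ρ i) : -(3 * max (-s) 0 ^ 2) * g ≤ 0 := by
  rcases le_or_gt 0 s with hs | hs
  · rw [max_eq_right (by linarith)]; simp
  have hsq : 0 ≤ 3 * max (-s) 0 ^ 2 := by positivity
  have hg : 0 ≤ g := by
    rcases hρ with ⟨h0, h1, hr⟩ | ⟨h0, hr⟩ | ⟨h0, hr⟩
    · have h2 := hr i
      have h3 : 0 ≤ (1 - α) * g := by nlinarith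
      exact nonneg_of_mul_nonneg_right h3 (by linarith)
    · rw [h0, hr i] at h; linarith
    · rw [h0, hr i] at h; linarith
  nlinarith

theorem IsClassicalSolution.nonneg (hn : 0 < n) (hΩo : IsOpen Ω)
    (hΩb : Bornology.IsBounded Ω) (hΩ : HasC1Boundary Ω) (hlam : ∀ i, 0 < lam i)
    (hρ : AdmissibleBoundaryData α ρ) (hF : SmoothQuasiPositive F)
    (hw : IsClassicalSolution lam F Ω α ρ Tmax w) {t : ℝ} (ht : 0 < t)
    (htT : (t : EReal) < Tmax) {x : EuclideanSpace ℝ (Fin n)} (hx : x ∈ closure Ω) (i : Fin m) :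
    0 ≤ w t x i := by
  obtain ⟨S, hS, hcut⟩ := exists_boundaryCutoff hn hΩo hΩb hΩ
  obtain ⟨G, hG⟩ := hw.boundary
  obtain ⟨R, hR⟩ := hw.locally_bounded t htT
  -- This `C` depends on the bound `R` of the particular solution. That does no harm: it multiplies
  -- an initial energy equal to zero.
  obtain ⟨C, hC, hreact⟩ := exists_negPart_reaction_le hF R
  have hlt : ∀ s ∈ Ioc 0 t, (s : EReal) < Tmax := fun s hs =>
    (EReal.coe_le_coe_iff.2 hs.2).trans_lt htT
  have hΨ0 : ∀ v : Fin m → ℝ, 0 ≤ ∑ i, max (-v i) 0 ^ 3 := fun v => by positivity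
  have hdens := isC2Density_negPart (m := m)
  have hle := integral_le_initial_of_isLyapunovAlong hn hΩo hΩb hΩ hw hF.locallyLipschitz.continuous
    hdens (fun i => (hG i).1) (fun i => (hG i).2.1) ht htT le_rfl le_rfl hC hS hcut
    (A := 0) (B := 0) ⟨fun s hs x hx => hΨ0 _, ?_, ?_, ?_⟩
  · have hini : ∫ x in Ω, ∑ i, max (-w 0 x i) 0 ^ 3 = 0 := by
      rw [integral_eq_zero_of_ae]
      filter_upwards [ae_all_iff.2 hw.initial_nonneg] with x hx
      exact Finset.sum_eq_zero fun i _ => by rw [max_eq_right (by linarith [hx i])]; norm_num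
    rw [hini] at hle
    simp only [zero_mul, add_zero, mul_zero] at hle
    have hinteg := hw.integrableOn_comp hΩb hdens.contDiff.continuous ht htT
    have hae := (integral_eq_zero_iff_of_nonneg (fun x => hΨ0 (w t x)) hinteg).1
      (le_antisymm hle (integral_nonneg fun x => hΨ0 (w t x)))
    -- A continuous function vanishing almost everywhere on an open set vanishes there identically;
    -- the closure follows by continuity of `w`.
    have heq := Measure.eqOn_open_of_ae_eq hae hΩo
      (hdens.contDiff.continuous.comp_continuousOn
        ((hw.continuousOn_slice ht htT).mono subset_closure)) continuousOn_const
    have hin : ∀ y ∈ Ω, 0 ≤ w t y i := by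
      intro y hy
      have h1 : ∑ i, max (-w t y i) 0 ^ 3 = 0 := heq hy
      have h2 := (Finset.sum_eq_zero_iff_of_nonneg
        (fun i _ => pow_nonneg (le_max_right _ _) 3)).1 h1 i (Finset.mem_univ i)
      have h3 := pow_eq_zero_iff (by norm_num) |>.1 h2
      have h4 := le_max_left (-w t y i) 0
      linarith
    have hlim : Tendsto (fun y => w t y i) (𝓝[Ω] x) (𝓝 (w t x i)) :=
      (((continuous_apply i).comp_continuousOn (hw.continuousOn_slice ht htT)) x hx).mono_left
        (nhdsWithin_mono x subset_closure)
    have : (𝓝[Ω] x).NeBot := mem_closure_iff_nhdsWithin_neBot.1 hx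
    exact ge_of_tendsto hlim (by filter_upwards [self_mem_nhdsWithin] with y hy using hin y hy)
  · intro s hs x hx ξ
    refine Finset.sum_nonneg fun i _ => ?_
    simp only [mul_ite, ite_mul, mul_zero, zero_mul, Finset.sum_ite_eq', Finset.mem_univ, if_true]
    have := hlam i
    have h1 : 0 ≤ max (-w s x i) 0 := le_max_right _ _
    exact mul_nonneg (by positivity) real_inner_self_nonneg
  · intro s hs y hy ν hν
    refine Finset.sum_nonpos fun i _ => ?_
    rw [mul_assoc]
    exact mul_nonpos_of_nonneg_of_nonpos (hlam i).le
      (negPart_flux_nonpos hρ ((hG i).2.2 (s, y) ⟨hs.1, hlt s hs, hy⟩ ν hν))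
  · intro s hs x hx
    rw [zero_add]
    exact hreact _ fun i => hR s hs x hx i

/-- At a boundary point where a nonnegative component vanishes, its outward normal derivative is
nonpositive. -/
lemma inner_normal_nonpos
    {f : EuclideanSpace ℝ (Fin n) → ℝ} {g : EuclideanSpace ℝ (Fin n) → EuclideanSpace ℝ (Fin n)}
    (hΩo : IsOpen Ω) (hf : ContinuousOn f (closure Ω)) (hd : DifferentiableOn ℝ f Ω)
    (hg : ContinuousOn g (closure Ω)) (hgf : ∀ x ∈ Ω, g x = gradient f x)
    (hf0 : ∀ x ∈ Ω, 0 ≤ f x) {y ν : EuclideanSpace ℝ (Fin n)} (hy : y ∈ frontier Ω)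
    (hν : IsOutwardNormal Ω y ν) (hfy : f y = 0) : inner ℝ (g y) ν ≤ 0 := by
  by_contra hcon
  rw [not_le] at hcon
  obtain ⟨φ, hφ, rfl⟩ := hν
  set ν := ‖gradient φ y‖⁻¹ • gradient φ y with hνdef
  have hg0 : 0 < ‖gradient φ y‖ := norm_pos_iff.2 hφ.2.1
  have hyc : y ∈ closure Ω := frontier_subset_closure hy
  -- Together with the negative slope of `φ` along `-ν`, this puts a short inward segment from `y`
  -- inside `Ω`.
  have hφy : φ y ≤ 0 := by
    by_contra h
    rw [not_le] at h
    have h1 := hφ.1.continuousAt.eventually (lt_mem_nhds h)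
    obtain ⟨z, hz, hzΩ⟩ := ((mem_closure_iff_frequently.1 hyc).and_eventually
      (h1.and hφ.2.2)).exists
    linarith [hzΩ.1, hzΩ.2.1 hz]
  have htend : Tendsto (fun s : ℝ => y + s • (-ν)) (𝓝[>] 0) (𝓝 y) := by
    have : Continuous (fun s : ℝ => y + s • (-ν)) := by fun_prop
    have h := this.tendsto 0
    simp only [zero_smul, add_zero] at h
    exact h.mono_left nhdsWithin_le_nhds
  have hin : ∀ᶠ s in 𝓝[>] (0 : ℝ), y + s • (-ν) ∈ Ω := by
    have h1 : HasDerivAt (fun s : ℝ => -φ (y + s • (-ν))) (-(inner ℝ (gradient φ y) (-ν))) 0 :=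
      (hφ.hasDerivAt_line (-ν)).fun_neg
    have h2 : 0 < -(inner ℝ (gradient φ y) (-ν)) := by
      rw [inner_neg_right, neg_neg, hνdef, real_inner_smul_right, real_inner_self_eq_norm_sq]
      positivity
    filter_upwards [eventually_lt_of_hasDerivAt_pos h1 h2, htend.eventually hφ.2.2] with s hs hs'
    simp only [zero_smul, add_zero] at hs
    exact hs'.2 (by linarith)
  have hpos : ∀ᶠ s in 𝓝[>] (0 : ℝ), 0 < inner ℝ (g (y + s • (-ν))) ν := by
    have h1 : Tendsto (fun s : ℝ => y + s • (-ν)) (𝓝[>] 0) (𝓝[closure Ω] y) :=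
      tendsto_nhdsWithin_iff.2 ⟨htend, hin.mono fun s hs => subset_closure hs⟩
    have h2 : Tendsto (fun s : ℝ => inner ℝ (g (y + s • (-ν))) ν) (𝓝[>] 0)
        (𝓝 (inner ℝ (g y) ν)) := ((hg y hyc).tendsto.comp h1).inner tendsto_const_nhds
    exact h2.eventually (lt_mem_nhds hcon)
  obtain ⟨r, hr, hrs⟩ := mem_nhdsGT_iff_exists_Ioc_subset.1 (hin.and hpos)
  have hr0 : (0 : ℝ) < r := hr
  have hderiv : ∀ s ∈ Ioc 0 r, HasDerivAt (fun s : ℝ => f (y + s • (-ν)))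
      (-(inner ℝ (g (y + s • (-ν))) ν)) s := by
    intro s hs
    have hsΩ := (hrs hs).1
    have h1 : HasDerivAt (fun s : ℝ => y + s • (-ν)) (-ν) s := by
      simpa using ((hasDerivAt_id s).smul_const (-ν)).const_add y
    have h2 := ((hd _ hsΩ).differentiableAt (hΩo.mem_nhds hsΩ)).hasFDerivAt.comp_hasDerivAt s h1
    rw [hgf _ hsΩ, inner_gradient_left, ← map_neg]
    exact h2
  -- If the normal derivative were positive, `f` would strictly decrease from `f y = 0` along the
  -- inward segment. Only derivatives in the interior of the segment enter, as `f` need not be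
  -- differentiable at `y`.
  have hanti : StrictAntiOn (fun s : ℝ => f (y + s • (-ν))) (Icc 0 r) := by
    apply strictAntiOn_of_deriv_neg (convex_Icc 0 r)
    · refine hf.comp (by fun_prop) fun s hs => ?_
      rcases eq_or_lt_of_le hs.1 with h | h
      · rw [← h, zero_smul, add_zero]; exact hyc
      · exact subset_closure (hrs ⟨h, hs.2⟩).1
    · intro s hs
      rw [interior_Icc] at hs
      rw [(hderiv s ⟨hs.1, hs.2.le⟩).deriv]
      have := (hrs ⟨hs.1, hs.2.le⟩).2
      linarith
  have h := hanti (left_mem_Icc.2 hr0.le) (right_mem_Icc.2 hr0.le) hr0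
  simp only [zero_smul, add_zero, hfy] at h
  have := hf0 _ (hrs ⟨hr0, le_rfl⟩).1
  linarith

end Nonneg

/-! ### Homogeneous polynomials in multinomial form and the choice of coefficients. -/

section Polynomials

variable {m : ℕ}

/-- The coefficients of a partial derivative: `γ ↦ c (γ + eᵢ)`. -/
def shiftCoeff (c : (Fin m → ℕ) → ℝ) (i : Fin m) : (Fin m → ℕ) → ℝ :=
  fun γ => c (γ + Pi.single i 1)

/-- The homogeneous polynomial `∑_{|γ| = p} (p! / γ!) c(γ) w^γ`, by recursion on the degree. -/
def symPoly : ℕ → ((Fin m → ℕ) → ℝ) → (Fin m → ℝ) → ℝ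
  | 0, c, _ => c 0
  | p + 1, c, w => ∑ i, w i * symPoly p (shiftCoeff c i) w

lemma shiftCoeff_comm (c : (Fin m → ℕ) → ℝ) (i j : Fin m) :
    shiftCoeff (shiftCoeff c i) j = shiftCoeff (shiftCoeff c j) i := by
  funext γ
  simp only [shiftCoeff, add_right_comm]

/-- Linearity in the coefficients. With `symPoly_mono` it reduces the Hessian and reaction
inequalities for the polynomial to inequalities for each exponent `γ`. -/
lemma symPoly_sum {ι : Type*} (s : Finset ι) (p : ℕ) (a : ι → ℝ) (c : ι → (Fin m → ℕ) → ℝ)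
    (w : Fin m → ℝ) :
    symPoly p (fun γ => ∑ k ∈ s, a k * c k γ) w = ∑ k ∈ s, a k * symPoly p (c k) w := by
  induction p generalizing c with
  | zero => rfl
  | succ p ih =>
    have h : ∀ i, shiftCoeff (fun γ => ∑ k ∈ s, a k * c k γ) i =
        fun γ => ∑ k ∈ s, a k * shiftCoeff (c k) i γ := fun i => rfl
    simp only [symPoly, h, ih, Finset.mul_sum]
    rw [Finset.sum_comm]
    exact Finset.sum_congr rfl fun k _ => Finset.sum_congr rfl fun i _ => by ring

lemma symPoly_mono {p : ℕ} {c c' : (Fin m → ℕ) → ℝ} {w : Fin m → ℝ} (hw : ∀ i, 0 ≤ w i)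
    (h : ∀ γ, ∑ i, γ i = p → c γ ≤ c' γ) : symPoly p c w ≤ symPoly p c' w := by
  induction p generalizing c c' with
  | zero => exact h 0 (by simp)
  | succ p ih =>
    refine Finset.sum_le_sum fun i _ => mul_le_mul_of_nonneg_left (ih fun γ hγ => h _ ?_) (hw i)
    simp [Finset.sum_add_distrib, hγ]

lemma symPoly_const (p : ℕ) (k : ℝ) (w : Fin m → ℝ) :
    symPoly p (fun _ => k) w = k * (∑ i, w i) ^ p := by
  induction p with
  | zero => simp [symPoly]
  | succ p ih =>
    have h : ∀ i, shiftCoeff (fun _ : Fin m → ℕ => k) i = fun _ => k := fun i => rfl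
    simp only [symPoly, h, ih]
    rw [← Finset.sum_mul]
    ring

lemma symPoly_nonneg {p : ℕ} {c : (Fin m → ℕ) → ℝ} {w : Fin m → ℝ} (hw : ∀ i, 0 ≤ w i)
    (h : ∀ γ, 0 ≤ c γ) : 0 ≤ symPoly p c w := by
  have := symPoly_mono (p := p) (c := fun _ => 0) (c' := c) hw fun γ _ => h γ
  rwa [symPoly_const, zero_mul] at this

lemma continuous_symPoly (p : ℕ) (c : (Fin m → ℕ) → ℝ) : Continuous (symPoly p c) := by
  induction p generalizing c with
  | zero => exact continuous_const
  | succ p ih =>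
    exact continuous_finsetSum _ fun i _ => (continuous_apply i).mul (ih _)

/-- In multinomial normalization, differentiation is a shift of the coefficients times the degree.
The truncated `p - 1` at `p = 0` is harmless because of the factor `p`. -/
lemma hasFDerivAt_symPoly (p : ℕ) (c : (Fin m → ℕ) → ℝ) (w : Fin m → ℝ) :
    HasFDerivAt (symPoly p c) (∑ i, ((p : ℝ) * symPoly (p - 1) (shiftCoeff c i) w) •
      ContinuousLinearMap.proj (R := ℝ) (φ := fun _ : Fin m => ℝ) i) w := by
  induction p generalizing c with
  | zero =>
    simp only [Nat.cast_zero, zero_mul, zero_smul, Finset.sum_const_zero]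
    exact hasFDerivAt_const (c 0) w
  | succ p ih =>
    have h1 := HasFDerivAt.fun_sum (u := Finset.univ) fun (i : Fin m) _ =>
      (hasFDerivAt_apply (𝕜 := ℝ) (F' := fun _ : Fin m => ℝ) i w).mul (ih (shiftCoeff c i))
    refine h1.congr_fderiv ?_
    -- Shifts commute, so the terms in which the inner polynomial is differentiated reassemble to
    -- `p` copies of the polynomial with coefficients shifted by `i`.
    have h2 : ∀ i, ((p : ℝ)) * ∑ j, w j * symPoly (p - 1) (shiftCoeff (shiftCoeff c j) i) w =
        p * symPoly p (shiftCoeff c i) w := by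
      intro i
      cases p with
      | zero => simp
      | succ q =>
        simp only [Nat.add_sub_cancel, symPoly]
        simp only [shiftCoeff_comm c i]
    rw [Finset.sum_add_distrib]
    simp only [Finset.smul_sum, smul_smul]
    rw [Finset.sum_comm, ← Finset.sum_add_distrib]
    refine Finset.sum_congr rfl fun i _ => ?_
    rw [← Finset.sum_smul, ← add_smul]
    congr 1
    have h3 : ∑ j, w j * (p * symPoly (p - 1) (shiftCoeff (shiftCoeff c j) i) w) =
        p * symPoly p (shiftCoeff c i) w := by
      rw [← h2 i, Finset.mul_sum]
      exact Finset.sum_congr rfl fun j _ => by ring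
    rw [h3, Nat.add_sub_cancel]
    push_cast
    ring

lemma isC2Density_symPoly (p : ℕ) (c : (Fin m → ℕ) → ℝ) :
    IsC2Density (symPoly p c) (fun i w => p * symPoly (p - 1) (shiftCoeff c i) w)
      (fun i j w => p * (((p - 1 : ℕ) : ℝ) *
        symPoly (p - 1 - 1) (shiftCoeff (shiftCoeff c i) j) w)) := by
  refine ⟨fun w => hasFDerivAt_symPoly p c w, fun i w => ?_, fun i j => ?_⟩
  · have := (hasFDerivAt_symPoly (p - 1) (shiftCoeff c i) w).const_mul (p : ℝ)
    simpa only [Finset.smul_sum, smul_smul] using this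
  · exact continuous_const.mul (continuous_const.mul (continuous_symPoly _ _))

lemma exists_coeff_bounds {c : (Fin m → ℕ) → ℝ} (hc : ∀ γ, 0 < c γ) (p : ℕ) :
    ∃ κ K : ℝ, 0 < κ ∧ 0 < K ∧ ∀ γ, ∑ i, γ i = p → κ ≤ c γ ∧ c γ ≤ K := by
  set s := Finset.piAntidiag (Finset.univ : Finset (Fin m)) p with hs
  have hmem : ∀ γ : Fin m → ℕ, ∑ i, γ i = p → γ ∈ s := fun γ hγ => by
    rw [hs, Finset.mem_piAntidiag]; exact ⟨hγ, fun i _ => Finset.mem_univ i⟩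
  have h1 : 0 ≤ ∑ γ ∈ s, (c γ)⁻¹ := Finset.sum_nonneg fun γ _ => (inv_pos.2 (hc γ)).le
  have h2 : 0 ≤ ∑ γ ∈ s, c γ := Finset.sum_nonneg fun γ _ => (hc γ).le
  -- The summand `1` keeps both bounds positive even if there is no exponent of degree `p`.
  refine ⟨(1 + ∑ γ ∈ s, (c γ)⁻¹)⁻¹, 1 + ∑ γ ∈ s, c γ, by positivity, by positivity,
    fun γ hγ => ⟨?_, ?_⟩⟩
  · have := Finset.single_le_sum (f := fun γ => (c γ)⁻¹) (fun γ _ => (inv_pos.2 (hc γ)).le)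
      (hmem γ hγ)
    exact inv_le_of_inv_le₀ (hc γ) (by linarith)
  · have := Finset.single_le_sum (f := c) (fun γ _ => (hc γ).le) (hmem γ hγ)
    linarith

lemma exists_symPoly_bounds {c : (Fin m → ℕ) → ℝ} (hc : ∀ γ, 0 < c γ) (p : ℕ) :
    ∃ κ K : ℝ, 0 < κ ∧ 0 < K ∧ ∀ w : Fin m → ℝ, (∀ i, 0 ≤ w i) →
      κ * (∑ i, w i) ^ p ≤ symPoly p c w ∧ symPoly p c w ≤ K * (∑ i, w i) ^ p := by
  obtain ⟨κ, K, hκ, hK, h⟩ := exists_coeff_bounds hc p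
  refine ⟨κ, K, hκ, hK, fun w hw => ?_⟩
  rw [← symPoly_const, ← symPoly_const]
  exact ⟨symPoly_mono hw fun γ hγ => (h γ hγ).1, symPoly_mono hw fun γ hγ => (h γ hγ).2⟩

/-- With all weights replaced by constants the nested sum is the binomial expansion of `(∑ w_i) ^
p`. The bounds are uniform in `p ≤ P` because the recursion visits all lower degrees. -/
lemma exists_lyapPoly_bounds {θ : ℕ → ℝ} (P k : ℕ) (hθ : ∀ j, 1 ≤ j → j ≤ k → 0 < θ j) :
    ∃ κ K : ℝ, 0 < κ ∧ 0 < K ∧ ∀ p ≤ P, ∀ w : Fin (k + 1) → ℝ, (∀ i, 0 ≤ w i) →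
      κ * (∑ i, w i) ^ p ≤ lyapPoly θ (k + 1) w p ∧
        lyapPoly θ (k + 1) w p ≤ K * (∑ i, w i) ^ p := by
  induction k with
  | zero =>
    refine ⟨1, 1, one_pos, one_pos, fun p _ w _ => ?_⟩
    simp [lyapPoly]
  | succ k ih =>
    obtain ⟨κ, K, hκ, hK, h⟩ := ih fun j h1 h2 => hθ j h1 (by omega)
    have hθk : 0 < θ (k + 1) := hθ (k + 1) (by omega) le_rfl
    obtain ⟨τ, τ', hτ, hτ', hb⟩ : ∃ τ τ' : ℝ, 0 < τ ∧ 0 < τ' ∧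
        ∀ q ≤ P, τ ≤ θ (k + 1) ^ (q ^ 2) ∧ θ (k + 1) ^ (q ^ 2) ≤ τ' := by
      have hp : ∀ q : ℕ, 0 < θ (k + 1) ^ (q ^ 2) := fun q => pow_pos hθk _
      have h1 : 0 ≤ ∑ q ∈ Finset.range (P + 1), (θ (k + 1) ^ (q ^ 2))⁻¹ :=
        Finset.sum_nonneg fun q _ => (inv_pos.2 (hp q)).le
      have h2 : 0 ≤ ∑ q ∈ Finset.range (P + 1), θ (k + 1) ^ (q ^ 2) :=
        Finset.sum_nonneg fun q _ => (hp q).le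
      refine ⟨(1 + ∑ q ∈ Finset.range (P + 1), (θ (k + 1) ^ (q ^ 2))⁻¹)⁻¹,
        1 + ∑ q ∈ Finset.range (P + 1), θ (k + 1) ^ (q ^ 2), by positivity, by positivity,
        fun q hq => ⟨?_, ?_⟩⟩
      · have := Finset.single_le_sum (f := fun q => (θ (k + 1) ^ (q ^ 2))⁻¹)
          (fun q _ => (inv_pos.2 (hp q)).le) (Finset.mem_range.2 (Nat.lt_succ_of_le hq))
        exact inv_le_of_inv_le₀ (hp q) (by linarith)
      · have := Finset.single_le_sum (f := fun q => θ (k + 1) ^ (q ^ 2))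
          (fun q _ => (hp q).le) (Finset.mem_range.2 (Nat.lt_succ_of_le hq))
        linarith
    refine ⟨τ * κ, τ' * K, by positivity, by positivity, fun p hp w hw => ?_⟩
    have hsum : (∑ i, w i) ^ p = ∑ q ∈ Finset.range (p + 1),
        (∑ i, Fin.init w i) ^ q * w (Fin.last (k + 1)) ^ (p - q) * (p.choose q) := by
      rw [Fin.sum_univ_castSucc, add_pow]
      rfl
    have hl : 0 ≤ w (Fin.last (k + 1)) := hw _
    have hi : ∀ i, 0 ≤ Fin.init w i := fun i => hw _
    have hs0 : 0 ≤ ∑ i, Fin.init w i := Finset.sum_nonneg fun i _ => hi i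
    rw [hsum, Finset.mul_sum, Finset.mul_sum, lyapPoly]
    constructor
    · refine Finset.sum_le_sum fun q hq => ?_
      have hqp : q ≤ P := by have := Finset.mem_range.1 hq; omega
      calc τ * κ * ((∑ i, Fin.init w i) ^ q * w (Fin.last (k + 1)) ^ (p - q) * (p.choose q))
          = (p.choose q) * τ * (κ * (∑ i, Fin.init w i) ^ q) * w (Fin.last (k + 1)) ^ (p - q) := by
            ring
        _ ≤ _ := by
            gcongr
            · exact (hb q hqp).1
            · exact (h q hqp _ hi).1
    · refine Finset.sum_le_sum fun q hq => ?_
      have hqp : q ≤ P := by have := Finset.mem_range.1 hq; omega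
      calc (p.choose q : ℝ) * θ (k + 1) ^ (q ^ 2) * lyapPoly θ (k + 1) (Fin.init w) q *
            w (Fin.last (k + 1)) ^ (p - q)
          ≤ (p.choose q) * τ' * (K * (∑ i, Fin.init w i) ^ q) *
              w (Fin.last (k + 1)) ^ (p - q) := by
            gcongr
            · exact (by positivity : (0 : ℝ) ≤ κ * (∑ i, Fin.init w i) ^ q).trans (h q hqp _ hi).1
            · exact (hb q hqp).2
            · exact (h q hqp _ hi).2
        _ = _ := by ring

/-- The coefficients `∏ₖ s^(γₖ²) dₖ^γₖ`. -/
def gaussCoeff (s : ℝ) (d : Fin m → ℝ) (γ : Fin m → ℕ) : ℝ := ∏ k, s ^ (γ k ^ 2) * d k ^ γ k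

lemma gaussCoeff_pos {s : ℝ} {d : Fin m → ℝ} (hs : 0 < s) (hd : ∀ i, 0 < d i) (γ : Fin m → ℕ) :
    0 < gaussCoeff s d γ :=
  Finset.prod_pos fun k _ => mul_pos (pow_pos hs _) (pow_pos (hd k) _)

/-- Since `(γ + 1)² - γ² = 2γ + 1`, a second shift in the same index produces an extra `s ^ 2`,
while shifts in different indices do not interact. -/
lemma gaussCoeff_add_single (s : ℝ) (d : Fin m → ℝ) (γ : Fin m → ℕ) (i : Fin m) :
    gaussCoeff s d (γ + Pi.single i 1) = gaussCoeff s d γ * (s ^ (2 * γ i + 1) * d i) := by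
  have h : s ^ (2 * γ i + 1) * d i =
      ∏ k, if k = i then s ^ (2 * γ k + 1) * d k else 1 := by
    rw [Finset.prod_ite_eq' Finset.univ i fun k => s ^ (2 * γ k + 1) * d k,
      if_pos (Finset.mem_univ i)]
  rw [h, gaussCoeff, gaussCoeff, ← Finset.prod_mul_distrib]
  refine Finset.prod_congr rfl fun k _ => ?_
  by_cases hk : k = i
  · subst hk
    simp only [Pi.add_apply, Pi.single_eq_same, if_true]
    ring
  · simp [hk]

/-- After rescaling `ξ` to `η`, the form is `∑ λ_i ⟨η_i, η_j⟩ + (s² - 1) ∑ λ_i ‖η_i‖²` up to a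
positive factor. By Cauchy–Schwarz the first sum is at least `-Λ m ∑ ‖η_i‖²`, which the second
absorbs. -/
lemma gaussCoeff_hessian_nonneg {E : Type*} [NormedAddCommGroup E] [InnerProductSpace ℝ E]
    {lam : Fin m → ℝ} {s μ Λ : ℝ} {d : Fin m → ℝ} (hs : 0 < s) (hd : ∀ i, 0 < d i)
    (hμ : ∀ i, μ ≤ lam i) (hlam : ∀ i, 0 ≤ lam i) (hΛ : ∀ i, lam i ≤ Λ)
    (hsμ : Λ * m ≤ (s ^ 2 - 1) * μ) (hs1 : 1 ≤ s) (γ : Fin m → ℕ) (ξ : Fin m → E) :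
    0 ≤ ∑ i, ∑ j, lam i * shiftCoeff (shiftCoeff (gaussCoeff s d) i) j γ * inner ℝ (ξ i) (ξ j) := by
  set η : Fin m → E := fun i => (s ^ (2 * γ i + 1) * d i) • ξ i with hη
  have hterm : ∀ i j, lam i * shiftCoeff (shiftCoeff (gaussCoeff s d) i) j γ * inner ℝ (ξ i) (ξ j)
      = gaussCoeff s d γ * (lam i * inner ℝ (η i) (η j) +
        if j = i then (s ^ 2 - 1) * lam i * ‖η i‖ ^ 2 else 0) := by
    intro i j
    have h1 : shiftCoeff (shiftCoeff (gaussCoeff s d) i) j γ = gaussCoeff s d γ *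
        (s ^ (2 * γ j + 1) * d j) * (s ^ (2 * (γ + Pi.single j 1 : Fin m → ℕ) i + 1) * d i) := by
      rw [← gaussCoeff_add_single, ← gaussCoeff_add_single]; rfl
    rw [h1]
    by_cases hij : j = i
    · subst hij
      rw [if_pos rfl, ← real_inner_self_eq_norm_sq, hη]
      simp only [real_inner_smul_left, real_inner_smul_right, Pi.add_apply, Pi.single_eq_same]
      ring
    · rw [if_neg hij, hη]
      simp only [real_inner_smul_left, real_inner_smul_right, Pi.add_apply]
      rw [Pi.single_eq_of_ne (fun h => hij h.symm)]
      ring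
  simp only [hterm, ← Finset.mul_sum, Finset.sum_add_distrib, Finset.sum_ite_eq', Finset.mem_univ,
    if_true]
  refine mul_nonneg (gaussCoeff_pos hs hd γ).le ?_
  have h1 : ∀ i, ∑ j, lam i * inner ℝ (η i) (η j) ≥ - (Λ * ∑ j, ‖η i‖ * ‖η j‖) := by
    intro i
    rw [Finset.mul_sum, ← Finset.sum_neg_distrib]
    refine Finset.sum_le_sum fun j _ => ?_
    have h2 := (abs_le.1 (abs_real_inner_le_norm (η i) (η j))).1
    have h3 : 0 ≤ ‖η i‖ * ‖η j‖ := by positivity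
    have h4 := mul_le_mul_of_nonneg_left h2 (hlam i)
    have h5 := mul_le_mul_of_nonneg_right (hΛ i) h3
    linarith
  have h2 : ∑ i, ∑ j, lam i * inner ℝ (η i) (η j) ≥ -(Λ * (∑ i, ‖η i‖) ^ 2) := by
    have h3 := Finset.sum_le_sum fun i (_ : i ∈ Finset.univ) => h1 i
    refine le_trans (le_of_eq ?_) h3
    rw [Finset.sum_neg_distrib, ← Finset.mul_sum, sq, Finset.sum_mul_sum]
  have h3 : (∑ i, ‖η i‖) ^ 2 ≤ m * ∑ i, ‖η i‖ ^ 2 := by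
    simpa using sq_sum_le_card_mul_sum_sq (s := Finset.univ) (f := fun i => ‖η i‖)
  have h4 : (s ^ 2 - 1) * μ * ∑ i, ‖η i‖ ^ 2 ≤ ∑ i, (s ^ 2 - 1) * lam i * ‖η i‖ ^ 2 := by
    rw [Finset.mul_sum]
    refine Finset.sum_le_sum fun i _ => ?_
    have : 0 ≤ s ^ 2 - 1 := by nlinarith
    exact mul_le_mul_of_nonneg_right (mul_le_mul_of_nonneg_left (hμ i) this) (sq_nonneg _)
  have h5 : 0 ≤ ∑ i, ‖η i‖ ^ 2 := Finset.sum_nonneg fun i _ => sq_nonneg _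
  rcases Nat.eq_zero_or_pos m with hm | hm
  · subst hm; simp
  have hΛ0 : 0 ≤ Λ := (hlam ⟨0, hm⟩).trans (hΛ _)
  have h6 := mul_le_mul_of_nonneg_left h3 hΛ0
  have h7 := mul_le_mul_of_nonneg_right hsμ h5
  simp only [← Finset.mul_sum] at h2
  linarith

/-- Weights for which the polynomial has a nonnegative diffusion Hessian and controls the
reaction terms. -/
theorem exists_lyapunov_coeff {lam : Fin m → ℝ} {F : (Fin m → ℝ) → Fin m → ℝ} (hm : 0 < m)
    (hlam : ∀ i, 0 < lam i) (hF : MassInequality F) (p : ℕ) :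
    ∃ c : (Fin m → ℕ) → ℝ, (∀ γ, 0 < c γ) ∧
      (∀ (n : ℕ) (γ : Fin m → ℕ) (ξ : Fin m → EuclideanSpace ℝ (Fin n)),
        0 ≤ ∑ i, ∑ j, lam i * shiftCoeff (shiftCoeff c i) j γ * inner ℝ (ξ i) (ξ j)) ∧
      ∃ K : ℝ, 0 ≤ K ∧ ∀ γ, ∑ i, γ i = p → ∀ w : Fin m → ℝ, (∀ i, 0 ≤ w i) →
        ∑ i, shiftCoeff c i γ * F w i ≤ K * (1 + ∑ i, w i) := by
  have hne : (Finset.univ : Finset (Fin m)).Nonempty := ⟨⟨0, hm⟩, Finset.mem_univ _⟩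
  obtain ⟨Dbar, hDbar, hD⟩ := hF
  obtain ⟨i₀, -, hi₀⟩ := Finset.exists_min_image Finset.univ lam hne
  have hμ0 : 0 < lam i₀ := hlam i₀
  set Λ := ∑ i, lam i with hΛ
  have hΛi : ∀ i, lam i ≤ Λ := fun i =>
    Finset.single_le_sum (f := lam) (fun i _ => (hlam i).le) (Finset.mem_univ i)
  have hΛ0 : 0 ≤ Λ := hμ0.le.trans (hΛi i₀)
  -- Chosen so that `(s - 1) * lam i₀ = Λ * m`; then `s ^ 2 - 1 ≥ s - 1` gives the diagonal
  -- dominance.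
  set s : ℝ := 1 + Λ * m / lam i₀ with hs
  have hq : 0 ≤ Λ * m / lam i₀ := by positivity
  have hs1 : 1 ≤ s := by linarith
  have hs0 : 0 < s := by linarith
  -- The factor `s ^ (2 * p)` compensates the worst ratio `s ^ (2 γ_i + 1) / s ^ (2 γ_l + 1)` over
  -- exponents of degree `p`, where `l` is the last index.
  set d : Fin m → ℝ := fun i => if (i : ℕ) + 1 = m then 1 else Dbar i * s ^ (2 * p) with hdd
  have hd : ∀ i, 0 < d i := by
    intro i
    simp only [hdd]
    split_ifs
    · exact one_pos
    · have := hDbar i; positivity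
  refine ⟨gaussCoeff s d, gaussCoeff_pos hs0 hd, fun n γ ξ => ?_, ?_⟩
  · refine gaussCoeff_hessian_nonneg (μ := lam i₀) (Λ := Λ) hs0 hd
      (fun i => hi₀ i (Finset.mem_univ i)) (fun i => (hlam i).le) hΛi ?_ hs1 γ ξ
    have h1 : s - 1 ≤ s ^ 2 - 1 := by nlinarith
    have h2 : (s - 1) * lam i₀ = Λ * m := by
      rw [hs]; field_simp; ring
    rw [← h2]
    exact mul_le_mul_of_nonneg_right h1 hμ0.le
  · set l : Fin m := ⟨m - 1, by omega⟩ with hl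
    have hll : (l : ℕ) + 1 = m := by simp only [hl]; omega
    have hkey : ∀ γ : Fin m → ℕ, ∃ K : ℝ, 0 ≤ K ∧ (∑ i, γ i = p → ∀ w : Fin m → ℝ,
        (∀ i, 0 ≤ w i) → ∑ i, shiftCoeff (gaussCoeff s d) i γ * F w i ≤ K * (1 + ∑ i, w i)) := by
      intro γ
      by_cases hγ : ∑ i, γ i = p
      swap
      · exact ⟨0, le_rfl, fun h => absurd h hγ⟩
      have hγl : γ l ≤ p := hγ ▸ Finset.single_le_sum (f := γ) (fun i _ => Nat.zero_le _)
        (Finset.mem_univ l)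
      -- These are the shifted coefficients divided by that of the last component. The value of `D`
      -- at the last index only has to satisfy the lower bound, since the mass inequality uses
      -- weight `1` there.
      set D : Fin m → ℝ := fun i => if (i : ℕ) + 1 = m then Dbar i else
        s ^ (2 * γ i + 1) * d i / s ^ (2 * γ l + 1) with hDD
      have hDge : ∀ i, Dbar i ≤ D i := by
        intro i
        simp only [hDD]
        split_ifs with h
        · exact le_rfl
        · rw [le_div_iff₀ (by positivity)]
          simp only [hdd, if_neg h]
          have h1 : s ^ (2 * γ l + 1) ≤ s ^ (2 * γ i + 1) * s ^ (2 * p) := by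
            rw [← pow_add]
            exact pow_le_pow_right₀ hs1 (by omega)
          have := mul_le_mul_of_nonneg_left h1 (hDbar i).le
          linarith
      obtain ⟨C₂, hC₂, hC⟩ := hD D hDge
      set q := gaussCoeff s d γ * s ^ (2 * γ l + 1) with hqq
      have hq0 : 0 < q := mul_pos (gaussCoeff_pos hs0 hd γ) (by positivity)
      refine ⟨q * C₂, by positivity, fun _ w hw => ?_⟩
      have h1 : ∑ i, shiftCoeff (gaussCoeff s d) i γ * F w i =
          q * ∑ i : Fin m, (if (i : ℕ) + 1 = m then 1 else D i) * F w i := by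
        rw [Finset.mul_sum]
        refine Finset.sum_congr rfl fun i _ => ?_
        rw [shiftCoeff, gaussCoeff_add_single, ← mul_assoc q]
        congr 1
        by_cases h : (i : ℕ) + 1 = m
        · have : i = l := Fin.ext (by omega)
          subst this
          rw [if_pos h, hqq]
          simp only [hdd, if_pos h]
          ring
        · rw [if_neg h, hqq]
          simp only [hDD, if_neg h]
          field_simp
      rw [h1, mul_assoc q C₂]
      exact mul_le_mul_of_nonneg_left (hC w hw) hq0.le
    choose K hK0 hK using hkey
    -- The constant of the mass inequality depends on `γ` through `D`; only finitely many exponents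
    -- have degree `p`, so a sum serves as a uniform bound.
    refine ⟨∑ γ ∈ Finset.piAntidiag Finset.univ p, K γ, Finset.sum_nonneg fun γ _ => hK0 γ,
      fun γ hγ w hw => (hK γ hγ w hw).trans ?_⟩
    have h1 : 0 ≤ ∑ i, w i := Finset.sum_nonneg fun i _ => hw i
    refine mul_le_mul_of_nonneg_right ?_ (by linarith)
    exact Finset.single_le_sum (f := K) (fun γ _ => hK0 γ)
      (by rw [Finset.mem_piAntidiag]; exact ⟨hγ, fun i _ => Finset.mem_univ i⟩)

end Polynomials

/-! ### Energy estimate for the auxiliary polynomial. -/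

section LyapunovEstimate

variable {m : ℕ} {lam : Fin m → ℝ} {F : (Fin m → ℝ) → Fin m → ℝ} {c : (Fin m → ℕ) → ℝ}

/-- The angle lies in `[0, π - π / (m + 1)]`, so its cosine is at least `-cos (π / (m + 1))`. -/
lemma lamBar_pos {a b : ℝ} (hb : 0 < b)
    (hab : 2 * b * Real.cos (Real.pi / ((m : ℝ) + 1)) < a) (i : Fin m) :
    0 < lamBar a b m ((i : ℕ) + 1) := by
  have hm : (0 : ℝ) < (m : ℝ) + 1 := by positivity
  have hi : ((i : ℕ) : ℝ) + 1 ≤ m := by exact_mod_cast i.2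
  have hπ := Real.pi_pos
  set x := ((m : ℝ) + 1 - (((i : ℕ) + 1 : ℕ) : ℝ)) * Real.pi / ((m : ℝ) + 1) with hx
  have hcast : (((i : ℕ) + 1 : ℕ) : ℝ) = (i : ℕ) + 1 := by push_cast; ring
  have hi0 : (0 : ℝ) ≤ (i : ℕ) := Nat.cast_nonneg _
  have hx0 : 0 ≤ x := by
    rw [hx, hcast]
    have : 0 ≤ (m : ℝ) + 1 - ((i : ℕ) + 1) := by linarith
    positivity
  have hx1 : x ≤ Real.pi - Real.pi / ((m : ℝ) + 1) := by
    rw [hx, hcast, div_le_iff₀ hm, sub_mul Real.pi, div_mul_cancel₀ _ hm.ne']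
    nlinarith
  have hcos : Real.cos (Real.pi - Real.pi / ((m : ℝ) + 1)) ≤ Real.cos x :=
    Real.cos_le_cos_of_nonneg_of_le_pi hx0 (by have : 0 ≤ Real.pi / ((m : ℝ) + 1) := by positivity
                                               linarith) hx1
  rw [Real.cos_pi_sub] at hcos
  have h1 : lamBar a b m ((i : ℕ) + 1) = a + 2 * b * Real.cos x := rfl
  rw [h1]
  nlinarith

lemma symPoly_hessian_nonneg {n : ℕ}
    (hc : ∀ (γ : Fin m → ℕ) (ξ : Fin m → EuclideanSpace ℝ (Fin n)),
      0 ≤ ∑ i, ∑ j, lam i * shiftCoeff (shiftCoeff c i) j γ * inner ℝ (ξ i) (ξ j))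
    (p : ℕ) {v : Fin m → ℝ} (hv : ∀ i, 0 ≤ v i) (ξ : Fin m → EuclideanSpace ℝ (Fin n)) :
    0 ≤ ∑ i, ∑ j, lam i * (p * (((p - 1 : ℕ) : ℝ) *
      symPoly (p - 1 - 1) (shiftCoeff (shiftCoeff c i) j) v)) * inner ℝ (ξ i) (ξ j) := by
  have h1 := symPoly_sum (Finset.univ : Finset (Fin m × Fin m)) (p - 1 - 1)
    (fun k => lam k.1 * inner ℝ (ξ k.1) (ξ k.2))
    (fun k => shiftCoeff (shiftCoeff c k.1) k.2) v
  have h2 : 0 ≤ symPoly (p - 1 - 1) (fun γ => ∑ k : Fin m × Fin m,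
      lam k.1 * inner ℝ (ξ k.1) (ξ k.2) * shiftCoeff (shiftCoeff c k.1) k.2 γ) v := by
    refine symPoly_nonneg hv fun γ => ?_
    rw [Fintype.sum_prod_type]
    refine (hc γ ξ).trans (le_of_eq ?_)
    exact Finset.sum_congr rfl fun i _ => Finset.sum_congr rfl fun j _ => by ring
  rw [h1, Fintype.sum_prod_type] at h2
  have h3 : (0 : ℝ) ≤ p * ((p - 1 : ℕ) : ℝ) := by positivity
  refine (mul_nonneg h3 h2).trans (le_of_eq ?_)
  simp only [Finset.mul_sum]
  exact Finset.sum_congr rfl fun i _ => Finset.sum_congr rfl fun j _ => by ring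

lemma pow_le_one_add_pow_succ {s : ℝ} (hs : 0 ≤ s) (q : ℕ) : s ^ q ≤ 1 + s ^ (q + 1) := by
  rcases le_total s 1 with h | h
  · have h1 := pow_le_one₀ hs h (n := q)
    have h2 := pow_nonneg hs (q + 1)
    linarith
  · exact (pow_le_pow_right₀ h (Nat.le_succ q)).trans (le_add_of_nonneg_left zero_le_one)

/-- The sum over components is a single polynomial of degree `q` whose coefficients are bounded by
`K (1 + s)`, `s = ∑ v_i`. The resulting growth `(1 + s) s ^ q` is at most a constant plus a multiple
of the polynomial of degree `q + 1`. -/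
lemma exists_symPoly_reaction_le (hc : ∀ γ, 0 < c γ) {q : ℕ} {K : ℝ} (hK0 : 0 ≤ K)
    (hK : ∀ γ, ∑ i, γ i = q → ∀ v : Fin m → ℝ, (∀ i, 0 ≤ v i) →
      ∑ i, shiftCoeff c i γ * F v i ≤ K * (1 + ∑ i, v i)) :
    ∃ A C : ℝ, 0 ≤ A ∧ 0 ≤ C ∧ ∀ v : Fin m → ℝ, (∀ i, 0 ≤ v i) →
      ∑ i, (((q + 1 : ℕ) : ℝ) * symPoly q (shiftCoeff c i) v) * F v i ≤
        A + C * symPoly (q + 1) c v := by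
  obtain ⟨κ, _, hκ, _, hb⟩ := exists_symPoly_bounds hc (q + 1)
  refine ⟨((q + 1 : ℕ) : ℝ) * K, 2 * ((q + 1 : ℕ) : ℝ) * K / κ, by positivity, by positivity,
    fun v hv => ?_⟩
  set s := ∑ i, v i with hs
  have hs0 : 0 ≤ s := Finset.sum_nonneg fun i _ => hv i
  have h1 : ∑ i, (((q + 1 : ℕ) : ℝ) * symPoly q (shiftCoeff c i) v) * F v i =
      ((q + 1 : ℕ) : ℝ) * symPoly q (fun γ => ∑ i, F v i * shiftCoeff c i γ) v := by
    rw [symPoly_sum, Finset.mul_sum]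
    exact Finset.sum_congr rfl fun i _ => by ring
  have h2 : symPoly q (fun γ => ∑ i, F v i * shiftCoeff c i γ) v ≤ K * (1 + s) * s ^ q := by
    rw [hs, ← symPoly_const]
    refine symPoly_mono hv fun γ hγ => (le_of_eq ?_).trans (hK γ hγ v hv)
    exact Finset.sum_congr rfl fun i _ => mul_comm _ _
  have h3 := pow_le_one_add_pow_succ hs0 q
  have h4 : s ^ (q + 1) ≤ symPoly (q + 1) c v / κ := by
    rw [le_div_iff₀ hκ, mul_comm]
    exact (hb v hv).1
  have h5 : (1 + s) * s ^ q ≤ 1 + 2 * (symPoly (q + 1) c v / κ) := by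
    have : (1 + s) * s ^ q = s ^ q + s ^ (q + 1) := by ring
    linarith
  rw [h1]
  calc ((q + 1 : ℕ) : ℝ) * symPoly q (fun γ => ∑ i, F v i * shiftCoeff c i γ) v
      ≤ ((q + 1 : ℕ) : ℝ) * (K * (1 + s) * s ^ q) := mul_le_mul_of_nonneg_left h2 (by positivity)
    _ = ((q + 1 : ℕ) : ℝ) * K * ((1 + s) * s ^ q) := by ring
    _ ≤ ((q + 1 : ℕ) : ℝ) * K * (1 + 2 * (symPoly (q + 1) c v / κ)) :=
        mul_le_mul_of_nonneg_left h5 (by positivity)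
    _ = _ := by ring

/-- In the Robin case the source contributes degree `q` in `s = ∑ v_i` and the loss degree `q + 1`
with a negative sign, so the flux is bounded above for all nonnegative boundary values. -/
lemma exists_symPoly_flux_le (hm : 0 < m) (hlam : ∀ i, 0 < lam i) (hc : ∀ γ, 0 < c γ)
    {α : ℝ} {ρ : Fin m → ℝ} (hρ : AdmissibleBoundaryData α ρ) (q : ℕ) :
    ∃ B : ℝ, 0 ≤ B ∧ ∀ v g : Fin m → ℝ, (∀ i, 0 ≤ v i) →
      (∀ i, α * v i + (1 - α) * g i = ρ i) → (α = 1 → ∀ i, g i ≤ 0) →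
      ∑ i, lam i * (((q + 1 : ℕ) : ℝ) * symPoly q (shiftCoeff c i) v) * g i ≤ B := by
  have ha : ∀ v : Fin m → ℝ, (∀ i, 0 ≤ v i) → ∀ i,
      0 ≤ ((q + 1 : ℕ) : ℝ) * symPoly q (shiftCoeff c i) v := fun v hv i =>
    mul_nonneg (Nat.cast_nonneg _) (symPoly_nonneg hv fun γ => (hc _).le)
  rcases hρ with ⟨h0, h1, hr⟩ | ⟨h0, hr⟩ | ⟨h0, hr⟩
  · obtain ⟨κ, _, hκ, _, hb⟩ := exists_symPoly_bounds hc (q + 1)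
    have hK : ∀ i, ∃ K : ℝ, 0 < K ∧ ∀ v : Fin m → ℝ, (∀ i, 0 ≤ v i) →
        symPoly q (shiftCoeff c i) v ≤ K * (∑ i, v i) ^ q := by
      intro i
      obtain ⟨_, K, _, hK, hKb⟩ := exists_symPoly_bounds (c := shiftCoeff c i) (fun γ => hc _) q
      exact ⟨K, hK, fun v hv => (hKb v hv).2⟩
    choose K hK0 hKb using hK
    obtain ⟨i₀, -, hi₀⟩ := Finset.exists_min_image Finset.univ lam ⟨⟨0, hm⟩, Finset.mem_univ _⟩
    have hμ := hlam i₀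
    set p : ℝ := ((q + 1 : ℕ) : ℝ) with hp
    have hp0 : 0 < p := by rw [hp]; positivity
    set k₁ : ℝ := ∑ i, lam i * (p * K i) * ρ i with hk₁
    have hk₁0 : 0 ≤ k₁ := Finset.sum_nonneg fun i _ =>
      mul_nonneg (mul_nonneg (hlam i).le (mul_nonneg hp0.le (hK0 i).le)) (hr i)
    set k₂ : ℝ := α * (lam i₀ * (p * κ)) with hk₂
    have hk₂0 : 0 < k₂ := by positivity
    have hα : 0 < 1 - α := by linarith
    refine ⟨(1 - α)⁻¹ * ((k₁ / k₂) ^ q * k₁), by positivity, fun v g hv hg _ => ?_⟩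
    set s := ∑ i, v i with hs
    have hs0 : 0 ≤ s := Finset.sum_nonneg fun i _ => hv i
    have hg' : ∀ i, g i = (1 - α)⁻¹ * (ρ i - α * v i) := by
      intro i
      rw [eq_inv_mul_iff_mul_eq₀ hα.ne']
      linarith [hg i]
    have e1 : ∑ i, lam i * (p * symPoly q (shiftCoeff c i) v) * g i =
        (1 - α)⁻¹ * (∑ i, lam i * (p * symPoly q (shiftCoeff c i) v) * ρ i -
          α * ∑ i, lam i * (p * symPoly q (shiftCoeff c i) v) * v i) := by
      rw [Finset.mul_sum, ← Finset.sum_sub_distrib, Finset.mul_sum]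
      exact Finset.sum_congr rfl fun i _ => by rw [hg' i]; ring
    have e2 : ∑ i, lam i * (p * symPoly q (shiftCoeff c i) v) * ρ i ≤ k₁ * s ^ q := by
      rw [hk₁, Finset.sum_mul]
      refine Finset.sum_le_sum fun i _ => ?_
      calc lam i * (p * symPoly q (shiftCoeff c i) v) * ρ i
          ≤ lam i * (p * (K i * s ^ q)) * ρ i :=
            mul_le_mul_of_nonneg_right (mul_le_mul_of_nonneg_left
              (mul_le_mul_of_nonneg_left (hKb i v hv) hp0.le) (hlam i).le) (hr i)
        _ = _ := by ring
    -- Euler's identity: the sum of `v i` times the shifted polynomials is the polynomial of degree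
    -- `q + 1`, which is at least `κ s ^ (q + 1)`.
    have e3 : lam i₀ * (p * κ) * s ^ (q + 1) ≤
        ∑ i, lam i * (p * symPoly q (shiftCoeff c i) v) * v i := by
      calc lam i₀ * (p * κ) * s ^ (q + 1) = lam i₀ * p * (κ * s ^ (q + 1)) := by ring
        _ ≤ lam i₀ * p * symPoly (q + 1) c v :=
            mul_le_mul_of_nonneg_left (hb v hv).1 (by positivity)
        _ = ∑ i, lam i₀ * (p * symPoly q (shiftCoeff c i) v) * v i := by
            rw [symPoly, Finset.mul_sum]
            exact Finset.sum_congr rfl fun i _ => by ring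
        _ ≤ _ := Finset.sum_le_sum fun i _ => mul_le_mul_of_nonneg_right
            (mul_le_mul_of_nonneg_right (hi₀ i (Finset.mem_univ i)) (ha v hv i)) (hv i)
    have e4 := mul_le_mul_of_nonneg_left e3 h0.le
    rw [e1]
    refine mul_le_mul_of_nonneg_left ?_ (inv_pos.2 hα).le
    have e5 : ∑ i, lam i * (p * symPoly q (shiftCoeff c i) v) * ρ i -
          α * ∑ i, lam i * (p * symPoly q (shiftCoeff c i) v) * v i ≤ s ^ q * (k₁ - k₂ * s) := by
      have : s ^ q * (k₁ - k₂ * s) = k₁ * s ^ q - α * (lam i₀ * (p * κ) * s ^ (q + 1)) := by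
        rw [hk₂]; ring
      linarith
    refine e5.trans ?_
    have hsq := pow_nonneg hs0 q
    -- The expression `s ^ q * (k₁ - k₂ * s)` is nonpositive beyond `k₁ / k₂` and at most `(k₁ / k₂)
    -- ^ q * k₁` before it.
    rcases le_total s (k₁ / k₂) with hle | hle
    · have h3 := pow_le_pow_left₀ hs0 hle q
      have h4 : 0 ≤ k₂ * s := by positivity
      calc s ^ q * (k₁ - k₂ * s) ≤ s ^ q * k₁ :=
            mul_le_mul_of_nonneg_left (by linarith) hsq
        _ ≤ _ := mul_le_mul_of_nonneg_right h3 hk₁0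
    · rw [div_le_iff₀ hk₂0] at hle
      have h3 : s ^ q * (k₁ - k₂ * s) ≤ 0 :=
        mul_nonpos_of_nonneg_of_nonpos hsq (by linarith)
      exact h3.trans (by positivity)
  · refine ⟨0, le_rfl, fun v g hv hg _ => le_of_eq (Finset.sum_eq_zero fun i _ => ?_)⟩
    have h2 := hg i
    rw [h0, hr i] at h2
    have h3 : g i = 0 := by linarith
    rw [h3, mul_zero]
  · exact ⟨0, le_rfl, fun v g hv _ hg => Finset.sum_nonpos fun i _ =>
      mul_nonpos_of_nonneg_of_nonpos (mul_nonneg (hlam i).le (ha v hv i)) (hg h0 i)⟩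

variable {n : ℕ} {Ω : Set (EuclideanSpace ℝ (Fin n))} {α : ℝ} {ρ : Fin m → ℝ}

/-- The integral of the auxiliary polynomial grows at most exponentially along every classical
solution, with constants that do not depend on the solution. -/
theorem exists_integral_symPoly_le (hm : 0 < m) (hn : 0 < n) (hΩo : IsOpen Ω)
    (hΩb : Bornology.IsBounded Ω) (hΩ : HasC1Boundary Ω) (hlam : ∀ i, 0 < lam i)
    (hρ : AdmissibleBoundaryData α ρ) (hF1 : SmoothQuasiPositive F) (hF3 : MassInequality F)
    (q : ℕ) :
    ∃ c : (Fin m → ℕ) → ℝ, (∀ γ, 0 < c γ) ∧ ∃ C D : ℝ, 0 ≤ C ∧ 0 ≤ D ∧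
      ∀ (Tmax : EReal) (w : ℝ → EuclideanSpace ℝ (Fin n) → Fin m → ℝ),
        IsClassicalSolution lam F Ω α ρ Tmax w → ∀ t : ℝ, 0 < t → (t : EReal) < Tmax →
          ∫ x in Ω, symPoly (q + 1) c (w t x) ≤
            Real.exp (C * t) * ((∫ x in Ω, symPoly (q + 1) c (w 0 x)) + D * t) := by
  obtain ⟨c, hc, hhess, K, hK0, hK⟩ := exists_lyapunov_coeff hm hlam hF3 q
  obtain ⟨A, C, hA, hC, hreact⟩ := exists_symPoly_reaction_le hc hK0 hK
  obtain ⟨B, hB, hflux⟩ := exists_symPoly_flux_le hm hlam hc hρ q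
  obtain ⟨S, hS, hcut⟩ := exists_boundaryCutoff hn hΩo hΩb hΩ
  refine ⟨c, hc, C, B * S + A * volume.real Ω, hC, by positivity, fun Tmax w hw t ht htT => ?_⟩
  obtain ⟨G, hG⟩ := hw.boundary
  have hlt : ∀ s ∈ Ioc 0 t, (s : EReal) < Tmax := fun s hs =>
    (EReal.coe_le_coe_iff.2 hs.2).trans_lt htT
  have hnn : ∀ s ∈ Ioc 0 t, ∀ x ∈ closure Ω, ∀ i, 0 ≤ w s x i := fun s hs x hx i =>
    hw.nonneg hn hΩo hΩb hΩ hlam hρ hF1 hs.1 (hlt s hs) hx i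
  refine integral_le_initial_of_isLyapunovAlong hn hΩo hΩb hΩ hw hF1.locallyLipschitz.continuous
    (isC2Density_symPoly (q + 1) c) (fun i => (hG i).1) (fun i => (hG i).2.1) ht htT hA hB hC hS
    hcut ⟨fun s hs x hx => symPoly_nonneg (hnn s hs x (subset_closure hx)) fun γ => (hc γ).le,
      fun s hs x hx ξ => symPoly_hessian_nonneg (hhess n) (q + 1)
        (hnn s hs x (subset_closure hx)) ξ,
      fun s hs y hy ν hν => ?_,
      fun s hs x hx => hreact _ (hnn s hs x (subset_closure hx))⟩
  have hyc : y ∈ closure Ω := frontier_subset_closure hy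
  have hbc : ∀ i, α * w s y i + (1 - α) * inner ℝ (G i s y) ν = ρ i := fun i =>
    (hG i).2.2 (s, y) ⟨hs.1, hlt s hs, hy⟩ ν hν
  refine hflux (w s y) (fun i => inner ℝ (G i s y) ν) (hnn s hs y hyc) hbc fun hα i => ?_
  have hρ0 : ρ i = 0 := by
    rcases hρ with ⟨-, h1, -⟩ | ⟨-, hr⟩ | ⟨-, hr⟩
    · exact absurd hα h1.ne
    · exact hr i
    · exact hr i
  -- For Dirichlet data the boundary condition says nothing about the normal derivative; its sign
  -- comes from `w ≥ 0` inside and `w = 0` at `y`.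
  have hw0 : w s y i = 0 := by
    have := hbc i
    rw [hα, hρ0] at this
    linarith
  refine inner_normal_nonpos (f := fun x => w s x i) (g := G i s) hΩo
    ((continuous_apply i).comp_continuousOn (hw.continuousOn_slice hs.1 (hlt s hs)))
    ((hw.space_contDiff i s hs.1 (hlt s hs)).differentiableOn (by norm_num))
    ((hG i).1.comp (f := fun x => (s, x)) (by fun_prop) fun x hx => ⟨hs.1, hlt s hs, hx⟩)
    (fun x hx => (hG i).2.1 (s, x) ⟨hs.1, hlt s hs, hx⟩)
    (fun x hx => hnn s hs x (subset_closure hx) i) hy hν hw0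

lemma continuous_lyapPoly (θ : ℕ → ℝ) (k p : ℕ) :
    Continuous fun w : Fin (k + 1) → ℝ => lyapPoly θ (k + 1) w p := by
  induction k generalizing p with
  | zero => exact (continuous_apply 0).pow p
  | succ k ih =>
    simp only [lyapPoly]
    refine continuous_finsetSum _ fun q _ => ?_
    have h1 : Continuous fun w : Fin (k + 2) → ℝ => (Fin.init w : Fin (k + 1) → ℝ) :=
      continuous_pi fun i => continuous_apply _
    exact (continuous_const.mul ((ih q).comp h1)).mul ((continuous_apply _).pow _)

end LyapunovEstimate

end ToeplitzRD

end

/-! ### Comparison of the two polynomials and conclusion. -/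

theorem theorem1 (m n : ℕ) (hm : 2 ≤ m) (hn : 0 < n)
    (a b : ℝ) (ha : 0 < a) (hb : 0 < b)
    (hab : 2 * b * Real.cos (Real.pi / ((m : ℝ) + 1)) < a)
    (Ω : Set (EuclideanSpace ℝ (Fin n))) (hΩo : IsOpen Ω) (hΩb : Bornology.IsBounded Ω)
    (hΩ : ToeplitzRD.HasC1Boundary Ω)
    (α : ℝ) (ρ : Fin m → ℝ) (hρ : ToeplitzRD.AdmissibleBoundaryData α ρ)
    (F : (Fin m → ℝ) → Fin m → ℝ)
    (hF1 : ToeplitzRD.SmoothQuasiPositive F)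
    (hF2 : ToeplitzRD.PolynomialGrowth F)
    (hF3 : ToeplitzRD.MassInequality F)
    (P : ℕ) (hP : 0 < P)
    (θ : ℕ → ℝ) (hθ : ∀ k, 1 ≤ k → k ≤ m - 1 → 0 < θ k)
    (hK : ToeplitzRD.DetCondition (ToeplitzRD.lamBar a b m) θ m P) :
    ∀ T M : ℝ, ∃ C : ℝ,
      ∀ (Tmax : EReal) (w : ℝ → EuclideanSpace ℝ (Fin n) → Fin m → ℝ), 0 < Tmax →
        ToeplitzRD.IsClassicalSolution (fun i : Fin m => ToeplitzRD.lamBar a b m (i + 1))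
          F Ω α ρ Tmax w →
        ToeplitzRD.lyapFunctional θ P Ω w 0 ≤ M →
        ∀ Tstar : ℝ, Tstar ≤ T → (Tstar : EReal) < Tmax →
          ∀ t ∈ Set.Icc 0 Tstar,
            MeasureTheory.IntegrableOn (fun x => ToeplitzRD.lyapPoly θ m (w t x) P) Ω ∧
              |ToeplitzRD.lyapFunctional θ P Ω w t| ≤ C := by
  open ToeplitzRD MeasureTheory in
  intro T M
  obtain ⟨k, rfl⟩ : ∃ k, m = k + 1 := ⟨m - 1, by omega⟩
  obtain ⟨q, rfl⟩ : ∃ q, P = q + 1 := ⟨P - 1, by omega⟩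
  have hlam : ∀ i : Fin (k + 1), 0 < lamBar a b (k + 1) (i + 1) := fun i => lamBar_pos hb hab i
  obtain ⟨c, hc, C, D, hC, hD, hmain⟩ := exists_integral_symPoly_le (Nat.succ_pos k) hn hΩo hΩb hΩ
    hlam hρ hF1 hF3 q
  obtain ⟨κ, K, hκ, hK0, hsym⟩ := exists_symPoly_bounds hc (q + 1)
  obtain ⟨κ', K', hκ', hK', hlyap⟩ := exists_lyapPoly_bounds (q + 1) k hθ
  -- The ratios `K' / κ` and `K / κ'` pass between the two polynomials at time `t` and at time `0`.
  -- Absolute values allow arbitrary real `T` and `M`, and the entry `M` covers `t = 0`, where `L(0)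
  -- ≤ M` is used directly.
  refine ⟨max M (K' / κ * (Real.exp (C * |T|) * (K / κ' * |M| + D * |T|))),
    fun Tmax w hTmax hw hM Tstar hT hTT t ht => ?_⟩
  have hcl := continuous_lyapPoly θ k (q + 1)
  have hcs := continuous_symPoly (m := k + 1) (q + 1) c
  have h0nn : ∀ᵐ x ∂(volume.restrict Ω), ∀ i, 0 ≤ w 0 x i := ae_all_iff.2 hw.initial_nonneg
  have hpos : ∀ v : Fin (k + 1) → ℝ, (∀ i, 0 ≤ v i) → 0 ≤ lyapPoly θ (k + 1) v (q + 1) :=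
    fun v hv => (mul_nonneg hκ'.le (pow_nonneg (Finset.sum_nonneg fun i _ => hv i) _)).trans
      (hlyap (q + 1) le_rfl v hv).1
  have hi0 := hw.integrableOn_comp_initial hΩb hcl
  rcases eq_or_lt_of_le ht.1 with h0 | h0
  · subst h0
    refine ⟨hi0, ?_⟩
    have hL0 : 0 ≤ lyapFunctional θ (q + 1) Ω w 0 :=
      integral_nonneg_of_ae (by filter_upwards [h0nn] with x hx using hpos _ hx)
    rw [abs_of_nonneg hL0]
    exact hM.trans (le_max_left _ _)
  have htT : (t : EReal) < Tmax := (EReal.coe_le_coe_iff.2 ht.2).trans_lt hTT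
  have hnn : ∀ x ∈ Ω, ∀ i, 0 ≤ w t x i := fun x hx i =>
    hw.nonneg hn hΩo hΩb hΩ hlam hρ hF1 h0 htT (subset_closure hx) i
  have hnn' : ∀ᵐ x ∂(volume.restrict Ω), ∀ i, 0 ≤ w t x i := by
    filter_upwards [ae_restrict_mem hΩo.measurableSet] with x hx using hnn x hx
  have hit := hw.integrableOn_comp hΩb hcl h0 htT
  refine ⟨hit, ?_⟩
  have hLt : 0 ≤ lyapFunctional θ (q + 1) Ω w t :=
    integral_nonneg_of_ae (by filter_upwards [hnn'] with x hx using hpos _ hx)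
  rw [abs_of_nonneg hLt]
  refine le_trans ?_ (le_max_right _ _)
  have htabs : t ≤ |T| := (ht.2.trans hT).trans (le_abs_self T)
  have h1 : lyapFunctional θ (q + 1) Ω w t ≤
      K' / κ * ∫ x in Ω, symPoly (q + 1) c (w t x) := by
    rw [lyapFunctional, ← integral_const_mul]
    refine integral_mono_ae hit ((hw.integrableOn_comp hΩb hcs h0 htT).const_mul _) ?_
    filter_upwards [hnn'] with x hx
    refine (hlyap (q + 1) le_rfl _ hx).2.trans ?_
    rw [div_mul_eq_mul_div, le_div_iff₀ hκ, mul_assoc, mul_comm _ κ]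
    exact mul_le_mul_of_nonneg_left (hsym _ hx).1 hK'.le
  have h2 : ∫ x in Ω, symPoly (q + 1) c (w 0 x) ≤ K / κ' * lyapFunctional θ (q + 1) Ω w 0 := by
    rw [lyapFunctional, ← integral_const_mul]
    refine integral_mono_ae (hw.integrableOn_comp_initial hΩb hcs) (hi0.const_mul _) ?_
    filter_upwards [h0nn] with x hx
    refine (hsym _ hx).2.trans ?_
    rw [div_mul_eq_mul_div, le_div_iff₀ hκ', mul_assoc, mul_comm _ κ']
    exact mul_le_mul_of_nonneg_left (hlyap (q + 1) le_rfl _ hx).1 hK0.le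
  have h3 : ∫ x in Ω, symPoly (q + 1) c (w 0 x) ≤ K / κ' * |M| :=
    h2.trans (mul_le_mul_of_nonneg_left (hM.trans (le_abs_self M)) (by positivity))
  refine h1.trans (mul_le_mul_of_nonneg_left ((hmain Tmax w hw t h0 htT).trans ?_) (by positivity))
  have h4 : (∫ x in Ω, symPoly (q + 1) c (w 0 x)) + D * t ≤ K / κ' * |M| + D * |T| :=
    add_le_add h3 (mul_le_mul_of_nonneg_left htabs hD)
  have h5 : 0 ≤ K / κ' * |M| + D * |T| := by positivity
  exact (mul_le_mul_of_nonneg_left h4 (Real.exp_pos _).le).trans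
    (mul_le_mul_of_nonneg_right (Real.exp_le_exp.2 (mul_le_mul_of_nonneg_left htabs hC)) h5)
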